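/- Let $d\ge 1$ and let $A,B\in\mathcal M_d(\mathbb C)$ be positive definite. For a Hermitian matrix $H$ let $\lambda(H)$ be the vector of its eigenvalues, counted with multiplicity and arranged in non-increasing order, and for $x\in\mathbb R^d$ let $D_x$ be the diagonal matrix with diagonal $x$. Let $N$ be a norm on $\mathcal M_d(\mathbb C)$ that is unitarily invariant, i.e. $N(UXV)=N(X)$ for all $X\in\mathcal M_d(\mathbb C)$ and all unitary $U,V$, and strictly convex, in the sense that its restriction to the diagonal matrices is a strictly convex norm on $\mathbb C^d$. Let $\mathcal O_B=\{U^*BU : U \text{ unitary}\}$ be the unitary orbit of $B$, with the metric induced by the operator norm, and let $$F_N:\mathcal O_B\to[0,\infty),\qquad F_N(C)=N\bigl(\log(A^{-1/2}CA^{-1/2})\bigr).$$ If $C_0\in\mathcal O_B$ is a local minimizer of $F_N$ on $\mathcal O_B$, then there is a unitary matrix $U$ such that $$U^*AU=D_{\lambda(A)}\quad\text{and}\quad U^*C_0U=D_{\lambda(B)} ,$$ and $C_0$ is a global minimizer of $F_N$ on $\mathcal O_B$. -/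

import Mathlib

open scoped ComplexOrder Matrix

namespace Procrustes

/-- The eigenvalues of a Hermitian matrix, repeated with multiplicity, in non-increasing order. -/
noncomputable def eigs {d : ℕ} {A : Matrix (Fin d) (Fin d) ℂ} (hA : A.IsHermitian) :
    Fin d → ℝ :=
  fun i => hA.eigenvalues₀ (Fin.cast (Fintype.card_fin d).symm i)

/-- The diagonal matrix `D_x` of a real vector `x`, as a complex matrix. -/
def diagMat {d : ℕ} (x : Fin d → ℝ) : Matrix (Fin d) (Fin d) ℂ :=
  Matrix.diagonal fun i => (x i : ℂ)

/-- The unitary orbit `{U* B U : U unitary}`; it consists of positive definite matrices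
when `B` is positive definite. -/
def unitaryOrbit {d : ℕ} (B : Matrix (Fin d) (Fin d) ℂ) : Set (Matrix (Fin d) (Fin d) ℂ) :=
  {C | ∃ U ∈ Matrix.unitaryGroup (Fin d) ℂ, C = Uᴴ * B * U}

/-- A norm on the complex vector space of matrices: a definite seminorm. -/
def IsNorm {d : ℕ} (N : Seminorm ℂ (Matrix (Fin d) (Fin d) ℂ)) : Prop :=
  ∀ X, N X = 0 → X = 0

/-- Unitary invariance: `N (U X V) = N X` for all unitary `U`, `V`. -/
def IsUnitarilyInvariant {d : ℕ} (N : Seminorm ℂ (Matrix (Fin d) (Fin d) ℂ)) : Prop :=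
  ∀ X : Matrix (Fin d) (Fin d) ℂ, ∀ U ∈ Matrix.unitaryGroup (Fin d) ℂ,
    ∀ V ∈ Matrix.unitaryGroup (Fin d) ℂ, N (U * X * V) = N X

/-- The restriction of `N` to the diagonal matrices is a strictly convex norm on `ℂ^d`:
the open segment between two distinct points of the closed unit ball lies in the open
unit ball. -/
def IsStrictlyConvexOnDiagonals {d : ℕ} (N : Seminorm ℂ (Matrix (Fin d) (Fin d) ℂ)) : Prop :=
  ∀ x y : Fin d → ℂ, x ≠ y → N (Matrix.diagonal x) ≤ 1 → N (Matrix.diagonal y) ≤ 1 →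
    ∀ a b : ℝ, 0 < a → 0 < b → a + b = 1 → N (Matrix.diagonal (a • x + b • y)) < 1

/-- `A^{-1/2}`, by the functional calculus of Hermitian matrices. -/
noncomputable def invSqrt {d : ℕ} (A : Matrix (Fin d) (Fin d) ℂ) : Matrix (Fin d) (Fin d) ℂ :=
  cfc (fun x : ℝ => (Real.sqrt x)⁻¹) A

/-- The logarithm of a positive definite matrix, by the functional calculus of Hermitian
matrices. -/
noncomputable def logm {d : ℕ} (M : Matrix (Fin d) (Fin d) ℂ) : Matrix (Fin d) (Fin d) ℂ :=
  cfc Real.log M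

/-- The function `C ↦ N (log (A^{-1/2} C A^{-1/2}))`. -/
noncomputable def logDist {d : ℕ} (N : Seminorm ℂ (Matrix (Fin d) (Fin d) ℂ))
    (A C : Matrix (Fin d) (Fin d) ℂ) : ℝ :=
  N (logm (invSqrt A * C * invSqrt A))

end Procrustes

/-! Write M = A^{-1/2} C A^{-1/2} and L = log M for a local minimizer C. The main point is that C
commutes with A.

Average L over the unitaries in the bicommutant of {A, C}. The average K commutes with A and C,
satisfies N(K) ≤ N(L), and tr Z(K − L) = 0 for every Z in the commutant of {A, C}
(`exists_commuting_average`). K commutes with L, so both are diagonal in one basis. If K ≠ L, strict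
convexity makes N(L + t(K − L)) decrease at a linear rate. A duality argument
(`exists_skew_tangent_solution`) writes the initial velocity M(K − L) of exp(L + t(K − L)) as the
velocity of A^{-1/2} e^{-tX} C e^{tX} A^{-1/2} plus that of a unitary conjugation of M, with X
skew-Hermitian. As N ignores unitary conjugation and the logarithm is locally Lipschitz
(`norm_logm_sub_logm_le`), the curve e^{-tX} C e^{tX} in the orbit of B decreases the distance to
first order, against minimality. So K = L, hence L, M and finally C commute with A
(`IsLocalMinOn.commute`).

In a common eigenbasis, suppose two eigenvalue pairs are ordered oppositely. A small rotation in
their plane keeps the determinant of the corresponding 2×2 block of M and lowers its trace, so the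
two logarithms move strictly towards each other with constant sum and N drops (`logDist_rotMat_lt`).
Hence the spectra are ordered alike.

The value at a local minimizer therefore depends only on the spectra of A and B. The orbit is
compact, so a global minimizer exists; being also a local one, it has this same value. -/

namespace Procrustes

/-! ### Matrices diagonal in a given orthonormal basis, and their functional calculus. -/

section Diagonalization

variable {d : ℕ}

/-- Real vectors, seen as matrices that are diagonal in the orthonormal basis given by the
columns of `U`. -/
noncomputable def diagAlgHom (U : Matrix (Fin d) (Fin d) ℂ)
    (hU : U ∈ Matrix.unitaryGroup (Fin d) ℂ) :
    (Fin d → ℝ) →ₐ[ℝ] Matrix (Fin d) (Fin d) ℂ :=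
  AlgHom.ofLinearMap
    { toFun := fun x => U * diagMat x * Uᴴ
      map_add' := fun x y => by
        have : diagMat (x + y) = diagMat x + diagMat y := by simp [diagMat]
        rw [this, mul_add, add_mul]
      map_smul' := fun r x => by
        have : diagMat (r • x) = r • diagMat x := by
          ext i j; by_cases h : i = j <;> simp [diagMat, h, Matrix.diagonal]
        rw [this]; simp }
    (by
      have : diagMat (1 : Fin d → ℝ) = 1 := by simp [diagMat]
      have hU' : U * Uᴴ = 1 := Matrix.mem_unitaryGroup_iff.mp hU
      simp [this, hU'])
    (fun x y => by
      have h : diagMat (x * y) = diagMat x * diagMat y := by simp [diagMat]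
      have hU' : Uᴴ * U = 1 := Matrix.mem_unitaryGroup_iff'.mp hU
      simp only [LinearMap.coe_mk, AddHom.coe_mk, h]
      calc U * (diagMat x * diagMat y) * Uᴴ
          = U * diagMat x * 1 * diagMat y * Uᴴ := by simp only [mul_one, mul_assoc]
        _ = _ := by rw [← hU']; simp only [mul_assoc])

lemma diagAlgHom_apply (U : Matrix (Fin d) (Fin d) ℂ)
    (hU : U ∈ Matrix.unitaryGroup (Fin d) ℂ) (x : Fin d → ℝ) :
    diagAlgHom U hU x = U * diagMat x * Uᴴ := rfl

lemma isHermitian_diagMat (x : Fin d → ℝ) : (diagMat x).IsHermitian :=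
  Matrix.isHermitian_diagonal_iff.mpr fun i => by simp [IsSelfAdjoint]

lemma isHermitian_diagAlgHom {U : Matrix (Fin d) (Fin d) ℂ}
    (hU : U ∈ Matrix.unitaryGroup (Fin d) ℂ) (x : Fin d → ℝ) :
    (diagAlgHom U hU x).IsHermitian :=
  Matrix.isHermitian_mul_mul_conjTranspose _ (isHermitian_diagMat x)

lemma conjTranspose_mul_diagAlgHom_mul {U : Matrix (Fin d) (Fin d) ℂ}
    (hU : U ∈ Matrix.unitaryGroup (Fin d) ℂ) (x : Fin d → ℝ) :
    Uᴴ * diagAlgHom U hU x * U = diagMat x := by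
  have hU' : Uᴴ * U = 1 := Matrix.mem_unitaryGroup_iff'.mp hU
  calc Uᴴ * (U * diagMat x * Uᴴ) * U = (Uᴴ * U) * diagMat x * (Uᴴ * U) := by
        simp only [mul_assoc]
    _ = _ := by rw [hU', one_mul, mul_one]

lemma charpoly_diagAlgHom {U : Matrix (Fin d) (Fin d) ℂ}
    (hU : U ∈ Matrix.unitaryGroup (Fin d) ℂ) (x : Fin d → ℝ) :
    (diagAlgHom U hU x).charpoly = (diagMat x).charpoly := by
  have hU' : Uᴴ * U = 1 := Matrix.mem_unitaryGroup_iff'.mp hU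
  rw [diagAlgHom_apply, Matrix.charpoly_mul_comm, ← mul_assoc, hU', one_mul]

lemma diagMat_mem_spectrum {x : Fin d → ℝ} {U : Matrix (Fin d) (Fin d) ℂ}
    (hU : U ∈ Matrix.unitaryGroup (Fin d) ℂ) {r : ℝ}
    (hr : r ∈ spectrum ℝ (diagAlgHom U hU x)) : ∃ i, x i = r := by
  have := AlgHom.spectrum_apply_subset (diagAlgHom U hU) x hr
  rw [Pi.spectrum_eq] at this
  simp only [Set.mem_iUnion] at this
  obtain ⟨i, hi⟩ := this
  refine ⟨i, ?_⟩
  by_contra hne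
  exact hi (spectrum.mem_resolventSet_iff.mpr (sub_ne_zero.mpr (Ne.symm hne)).isUnit)

/-- On a finite spectrum f agrees with a Lagrange interpolation polynomial, and polynomials commute
with algebra homomorphisms. -/
lemma cfc_diagAlgHom (f : ℝ → ℝ) {U : Matrix (Fin d) (Fin d) ℂ}
    (hU : U ∈ Matrix.unitaryGroup (Fin d) ℂ) (x : Fin d → ℝ) :
    cfc f (diagAlgHom U hU x) = diagAlgHom U hU (fun i => f (x i)) := by
  classical
  set p := Lagrange.interpolate (Finset.univ.image x) id f
  have hp : ∀ i, p.eval (x i) = f (x i) := fun i =>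
    Lagrange.eval_interpolate_at_node (v := id) f (Set.injOn_id _)
      (Finset.mem_image_of_mem x (Finset.mem_univ i))
  have h1 : cfc f (diagAlgHom U hU x) = cfc p.eval (diagAlgHom U hU x) := by
    refine cfc_congr fun r hr => ?_
    obtain ⟨i, rfl⟩ := diagMat_mem_spectrum hU hr
    exact (hp i).symm
  have h2 := cfc_polynomial p _ (isHermitian_diagAlgHom hU x).isSelfAdjoint
  rw [h1]
  refine h2.trans ?_
  rw [Polynomial.aeval_algHom_apply]
  congr 1
  ext i
  rw [Polynomial.aeval_pi_apply]
  simpa using hp i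

lemma exists_eq_diagAlgHom {H : Matrix (Fin d) (Fin d) ℂ} (hH : H.IsHermitian) :
    ∃ (U : Matrix (Fin d) (Fin d) ℂ) (hU : U ∈ Matrix.unitaryGroup (Fin d) ℂ),
      H = diagAlgHom U hU hH.eigenvalues := by
  refine ⟨hH.eigenvectorUnitary, hH.eigenvectorUnitary.2, ?_⟩
  conv_lhs => rw [hH.spectral_theorem, Unitary.conjStarAlgAut_apply]
  rfl

lemma posDef_diagAlgHom {U : Matrix (Fin d) (Fin d) ℂ}
    (hU : U ∈ Matrix.unitaryGroup (Fin d) ℂ) {x : Fin d → ℝ} (hx : ∀ i, 0 < x i) :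
    (diagAlgHom U hU x).PosDef := by
  have hU' : U * Uᴴ = 1 := Matrix.mem_unitaryGroup_iff.mp hU
  have := (Matrix.PosDef.diagonal (d := fun i => ((x i : ℝ) : ℂ))
    (fun i => by simpa using hx i)).mul_mul_conjTranspose_same
    (B := U) (Matrix.vecMul_injective_of_isUnit (IsUnit.of_mul_eq_one _ hU'))
  exact this

lemma pos_of_posDef_diagAlgHom {U : Matrix (Fin d) (Fin d) ℂ}
    (hU : U ∈ Matrix.unitaryGroup (Fin d) ℂ) {x : Fin d → ℝ}
    (h : (diagAlgHom U hU x).PosDef) (i : Fin d) : 0 < x i := by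
  have hU' : Uᴴ * U = 1 := Matrix.mem_unitaryGroup_iff'.mp hU
  have := h.conjTranspose_mul_mul_same (B := U)
    (Matrix.mulVec_injective_of_isUnit (IsUnit.of_mul_eq_one_right _ hU'))
  rw [conjTranspose_mul_diagAlgHom_mul] at this
  have h2 := Matrix.PosDef.diag_pos this (i := i)
  simpa [diagMat] using h2

/-- The ordered eigenvalues are the sorted roots of the characteristic polynomial, so no eigenbasis
has to be compared with another. -/
lemma eigs_eq_of_antitone {H : Matrix (Fin d) (Fin d) ℂ} (hH : H.IsHermitian) {x : Fin d → ℝ}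
    (hx : Antitone x) (h : H.charpoly = (diagMat x).charpoly) : eigs hH = x := by
  have h1 := hH.sort_roots_charpoly_eq_eigenvalues₀
  have h2 : (diagMat x).charpoly.roots = Multiset.map (fun i => (x i : ℂ)) Finset.univ.val := by
    rw [diagMat, Matrix.charpoly_diagonal, Polynomial.roots_prod]
    · simp
    · simp [Finset.prod_ne_zero_iff, Polynomial.X_sub_C_ne_zero]
  rw [h, h2] at h1
  have h3 : ((Multiset.map (fun i => (x i : ℂ)) Finset.univ.val).map RCLike.re).sort (· ≥ ·)
      = List.ofFn x := by
    simp_rw [Fin.univ_val_map, Multiset.map_coe, List.map_ofFn,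
      Function.comp_def, RCLike.re_to_complex, Complex.ofReal_re, Multiset.coe_sort]
    apply List.mergeSort_of_pairwise
    simp_rw [decide_eq_true_eq, ← List.sortedGE_iff_pairwise]
    exact hx.sortedGE_ofFn
  rw [h3] at h1
  have h4 : List.ofFn x = List.ofFn (eigs hH) := by
    rw [h1]
    exact List.ofFn_congr (Fintype.card_fin d) _
  exact (List.ofFn_injective h4).symm

/-- The joint eigenspaces of commuting symmetric operators are orthogonal and span; the columns of U
are an orthonormal basis subordinate to them. -/
lemma exists_simultaneous_diagAlgHom {A C : Matrix (Fin d) (Fin d) ℂ} (hA : A.IsHermitian)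
    (hC : C.IsHermitian) (hAC : Commute A C) :
    ∃ (U : Matrix (Fin d) (Fin d) ℂ) (hU : U ∈ Matrix.unitaryGroup (Fin d) ℂ)
      (a c : Fin d → ℝ), A = diagAlgHom U hU a ∧ C = diagAlgHom U hU c := by
  classical
  have hA' := Matrix.isSymmetric_toEuclideanLin_iff.mpr hA
  have hC' := Matrix.isSymmetric_toEuclideanLin_iff.mpr hC
  have hcomm : Commute (Matrix.toEuclideanLin A) (Matrix.toEuclideanLin C) := by
    ext v : 1
    apply (WithLp.ofLp_injective 2)
    simp [Matrix.toEuclideanLin, Matrix.toLpLin_apply, hAC.eq]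
  have hint₀ := hA'.directSum_isInternal_of_commute hC' hcomm
  -- The joint eigenspaces are indexed by all of ℂ × ℂ; discarding the zero ones leaves a finite
  -- index type.
  have hint := DirectSum.isInternal_ne_bot_iff.mpr hint₀
  have horth := (hA'.orthogonalFamily_eigenspace_inf_eigenspace hC').comp
    (Subtype.val_injective (p := fun i : ℂ × ℂ =>
      Module.End.eigenspace (Matrix.toEuclideanLin A) i.2 ⊓
        Module.End.eigenspace (Matrix.toEuclideanLin C) i.1 ≠ ⊥))
  have : Finite {i : ℂ × ℂ // Module.End.eigenspace (Matrix.toEuclideanLin A) i.2 ⊓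
        Module.End.eigenspace (Matrix.toEuclideanLin C) i.1 ≠ ⊥} :=
    (WellFoundedGT.finite_ne_bot_of_iSupIndep hint₀.submodule_iSupIndep).to_subtype
  let _ := Fintype.ofFinite {i : ℂ × ℂ // Module.End.eigenspace (Matrix.toEuclideanLin A) i.2 ⊓
        Module.End.eigenspace (Matrix.toEuclideanLin C) i.1 ≠ ⊥}
  have hn : Module.finrank ℂ (EuclideanSpace ℂ (Fin d)) = d := by simp
  set b := hint.subordinateOrthonormalBasis hn horth
  -- The second component of the index is the eigenvalue of A, the first that of C.
  set ix : Fin d → ℂ × ℂ := fun j => Subtype.val <| hint.subordinateOrthonormalBasisIndex hn j horth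
  have hmem : ∀ j, b j ∈ _ := fun j =>
    hint.subordinateOrthonormalBasis_subordinate hn j horth
  have hreal : ∀ (T : EuclideanSpace ℂ (Fin d) →ₗ[ℂ] EuclideanSpace ℂ (Fin d))
      (_ : T.IsSymmetric) (z : ℂ) (j : Fin d), T (b j) = z • b j → T (b j) = ((z.re : ℝ) : ℂ) • b j := by
    intro T hT z j h
    have hz : Module.End.HasEigenvalue T z :=
      Module.End.hasEigenvalue_of_hasEigenvector
        ⟨Module.End.mem_eigenspace_iff.mpr h, b.orthonormal.ne_zero j⟩
    rw [h, Complex.conj_eq_iff_re.mp (hT.conj_eigenvalue_eq_self hz)]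
  have hAj : ∀ j, Matrix.toEuclideanLin A (b j) = (((ix j).2.re : ℝ) : ℂ) • b j := fun j =>
    hreal _ hA' _ j (Module.End.mem_eigenspace_iff.mp (hmem j).1)
  have hCj : ∀ j, Matrix.toEuclideanLin C (b j) = (((ix j).1.re : ℝ) : ℂ) • b j := fun j =>
    hreal _ hC' _ j (Module.End.mem_eigenspace_iff.mp (hmem j).2)
  set U : Matrix (Fin d) (Fin d) ℂ :=
    (EuclideanSpace.basisFun (Fin d) ℂ).toBasis.toMatrix b.toBasis with hUdef
  have hU : U ∈ Matrix.unitaryGroup (Fin d) ℂ :=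
    OrthonormalBasis.toMatrix_orthonormalBasis_mem_unitary _ _
  have hUe : ∀ i j, U i j = b j i := fun i j => by simp [hUdef, Module.Basis.toMatrix_apply]
  have key : ∀ (M : Matrix (Fin d) (Fin d) ℂ) (x : Fin d → ℝ),
      (∀ j, Matrix.toEuclideanLin M (b j) = ((x j : ℝ) : ℂ) • b j) →
      M = diagAlgHom U hU x := by
    intro M x h
    have h1 : M * U = U * diagMat x := by
      ext i j
      have := congrArg (fun v : EuclideanSpace ℂ (Fin d) => v i) (h j)
      simp only [Matrix.toEuclideanLin, Matrix.toLpLin_apply, Matrix.mulVec, dotProduct,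
        PiLp.smul_apply, smul_eq_mul] at this
      rw [diagMat, Matrix.mul_diagonal, Matrix.mul_apply, hUe, mul_comm, ← this]
      simp [hUe]
    have hU' : U * Uᴴ = 1 := Matrix.mem_unitaryGroup_iff.mp hU
    rw [diagAlgHom_apply, ← h1, mul_assoc, hU', mul_one]
  exact ⟨U, hU, _, _, key A _ hAj, key C _ hCj⟩

end Diagonalization

/-! ### Unitarily invariant, strictly convex norms on real diagonals. -/

section Norm

variable {d : ℕ} {N : Seminorm ℂ (Matrix (Fin d) (Fin d) ℂ)}

open scoped Matrix.Norms.Elementwise in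
lemma continuous_seminorm (N : Seminorm ℂ (Matrix (Fin d) (Fin d) ℂ)) : Continuous N := by
  have h := (N.restrictScalars ℝ).convexOn.continuousOn isOpen_univ
  exact continuousOn_univ.mp h

lemma IsUnitarilyInvariant.conj (hinv : IsUnitarilyInvariant N)
    {U : Matrix (Fin d) (Fin d) ℂ} (hU : U ∈ Matrix.unitaryGroup (Fin d) ℂ)
    (X : Matrix (Fin d) (Fin d) ℂ) : N (U * X * Uᴴ) = N X :=
  hinv X U hU Uᴴ (Unitary.star_mem hU)

lemma IsUnitarilyInvariant.diagAlgHom (hinv : IsUnitarilyInvariant N)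
    {U : Matrix (Fin d) (Fin d) ℂ} (hU : U ∈ Matrix.unitaryGroup (Fin d) ℂ)
    (x : Fin d → ℝ) : N (diagAlgHom U hU x) = N (diagMat x) :=
  hinv.conj hU _

/-- Dividing by r = N(D_x) puts both points in the closed unit ball; r = 0 would force x = y = 0. -/
lemma IsStrictlyConvexOnDiagonals.lt (hconv : IsStrictlyConvexOnDiagonals N) (hN : IsNorm N)
    {x y : Fin d → ℝ} (hxy : x ≠ y) (hle : N (diagMat y) ≤ N (diagMat x)) {t : ℝ}
    (ht0 : 0 < t) (ht1 : t < 1) :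
    N (diagMat ((1 - t) • x + t • y)) < N (diagMat x) := by
  have hr : 0 < N (diagMat x) := by
    refine lt_of_le_of_ne (apply_nonneg N _) fun h0 => hxy ?_
    have hx := hN _ h0.symm
    have hy := hN _ (le_antisymm (hle.trans h0.ge) (apply_nonneg N _))
    have h := hx.trans hy.symm
    funext i
    have := congrFun (congrFun h i) i
    simpa [diagMat] using this
  set r := N (diagMat x)
  have hdiag : ∀ z : Fin d → ℝ, Matrix.diagonal (fun i => ((r⁻¹ * z i : ℝ) : ℂ))
      = ((r⁻¹ : ℝ) : ℂ) • diagMat z := by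
    intro z
    ext i j
    by_cases h : i = j <;> simp [diagMat, h, Matrix.diagonal]
  have hnorm : ∀ z : Fin d → ℝ, N (Matrix.diagonal (fun i => ((r⁻¹ * z i : ℝ) : ℂ)))
      = r⁻¹ * N (diagMat z) := by
    intro z
    rw [hdiag, map_smul_eq_mul, Complex.norm_real, Real.norm_of_nonneg (inv_nonneg.mpr hr.le)]
  have h := hconv (fun i => ((r⁻¹ * x i : ℝ) : ℂ)) (fun i => ((r⁻¹ * y i : ℝ) : ℂ))
    (fun he => hxy (by
      funext i
      have := congrFun he i
      exact mul_left_cancel₀ (inv_ne_zero hr.ne') (Complex.ofReal_injective this)))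
    (by rw [hnorm]; exact (inv_mul_cancel₀ hr.ne').le)
    (by
      rw [hnorm]
      calc r⁻¹ * N (diagMat y) ≤ r⁻¹ * r := by gcongr
        _ = 1 := inv_mul_cancel₀ hr.ne')
    (1 - t) t (by linarith) ht0 (by ring)
  have he : ((1 - t) • (fun i => ((r⁻¹ * x i : ℝ) : ℂ)) + t • fun i => ((r⁻¹ * y i : ℝ) : ℂ))
      = fun i => ((r⁻¹ * ((1 - t) • x + t • y) i : ℝ) : ℂ) := by
    funext i
    simp only [Pi.add_apply, Pi.smul_apply, Complex.real_smul, smul_eq_mul]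
    push_cast
    ring
  rw [he, hnorm, inv_mul_lt_iff₀ hr, mul_one] at h
  exact h

lemma IsUnitarilyInvariant.diagMat_comp_perm (hinv : IsUnitarilyInvariant N) (x : Fin d → ℝ)
    (σ : Equiv.Perm (Fin d)) : N (diagMat (x ∘ σ)) = N (diagMat x) := by
  set P : Matrix (Fin d) (Fin d) ℂ := (1 : Matrix (Fin d) (Fin d) ℂ).submatrix σ id with hP
  have hPh : Pᴴ = (1 : Matrix (Fin d) (Fin d) ℂ).submatrix id σ := by
    rw [hP, Matrix.conjTranspose_submatrix, Matrix.conjTranspose_one]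
  have hmem : P ∈ Matrix.unitaryGroup (Fin d) ℂ := by
    rw [Matrix.mem_unitaryGroup_iff, Matrix.star_eq_conjTranspose, hPh, hP]
    ext i j
    simp [Matrix.mul_apply, Matrix.one_apply]
  have : diagMat (x ∘ σ) = P * diagMat x * Pᴴ := by
    rw [hPh]
    ext i j
    simp [hP, diagMat, Matrix.mul_apply, Matrix.diagonal, Matrix.one_apply]
    by_cases h : i = j <;> simp [h]
  rw [this, hinv.conj hmem]

end Norm

/-! ### The distance between commuting matrices. -/

section LogDist

variable {d : ℕ} {N : Seminorm ℂ (Matrix (Fin d) (Fin d) ℂ)}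

lemma invSqrt_diagAlgHom {U : Matrix (Fin d) (Fin d) ℂ}
    (hU : U ∈ Matrix.unitaryGroup (Fin d) ℂ) (a : Fin d → ℝ) :
    invSqrt (diagAlgHom U hU a) = diagAlgHom U hU (fun i => (√(a i))⁻¹) :=
  cfc_diagAlgHom _ hU a

lemma logm_diagAlgHom {U : Matrix (Fin d) (Fin d) ℂ}
    (hU : U ∈ Matrix.unitaryGroup (Fin d) ℂ) (a : Fin d → ℝ) :
    logm (diagAlgHom U hU a) = diagAlgHom U hU (fun i => Real.log (a i)) :=
  cfc_diagAlgHom _ hU a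

lemma logDist_diagAlgHom (hinv : IsUnitarilyInvariant N) {U : Matrix (Fin d) (Fin d) ℂ}
    (hU : U ∈ Matrix.unitaryGroup (Fin d) ℂ) {a : Fin d → ℝ} (ha : ∀ i, 0 < a i)
    (c : Fin d → ℝ) :
    logDist N (diagAlgHom U hU a) (diagAlgHom U hU c)
      = N (diagMat fun i => Real.log (c i / a i)) := by
  have : (fun i => (√(a i))⁻¹) * c * (fun i => (√(a i))⁻¹) = fun i => c i / a i := by
    funext i
    have := Real.mul_self_sqrt (ha i).le
    have h0 : √(a i) ≠ 0 := (Real.sqrt_pos.mpr (ha i)).ne'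
    simp only [Pi.mul_apply]
    nth_rewrite 3 [← this]
    field_simp
  rw [logDist, invSqrt_diagAlgHom, ← map_mul, ← map_mul, this, logm_diagAlgHom, hinv.diagAlgHom]

lemma mem_unitaryOrbit_conj {B C : Matrix (Fin d) (Fin d) ℂ} (hC : C ∈ unitaryOrbit B)
    {U : Matrix (Fin d) (Fin d) ℂ} (hU : U ∈ Matrix.unitaryGroup (Fin d) ℂ) :
    Uᴴ * C * U ∈ unitaryOrbit B := by
  obtain ⟨V, hV, rfl⟩ := hC
  exact ⟨V * U, mul_mem hV hU, by simp only [Matrix.conjTranspose_mul, mul_assoc]⟩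

end LogDist

/-! ### Unitaries acting on a few coordinates only. -/

section Embedding

variable {d m : ℕ}

/-- The isometry sending the `a`-th basis vector to the `σ a`-th one. -/
def selMat (σ : Fin m → Fin d) : Matrix (Fin d) (Fin m) ℂ :=
  (1 : Matrix (Fin d) (Fin d) ℂ).submatrix id σ

/-- The matrix acting as `w` on the coordinates in the range of `σ`, and trivially on the
others. -/
def embMat (σ : Fin m → Fin d) (w : Matrix (Fin m) (Fin m) ℂ) : Matrix (Fin d) (Fin d) ℂ :=
  1 + selMat σ * (w - 1) * (selMat σ)ᴴ

lemma selMat_conjTranspose_mul {σ : Fin m → Fin d} (hσ : Function.Injective σ) :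
    (selMat σ)ᴴ * selMat σ = 1 := by
  ext a b
  simp [selMat, Matrix.mul_apply, Matrix.one_apply, hσ.eq_iff]

lemma diagMat_mul_selMat (σ : Fin m → Fin d) (x : Fin d → ℝ) :
    diagMat x * selMat σ = selMat σ * diagMat (x ∘ σ) := by
  ext k a
  by_cases h : k = σ a <;>
  simp [selMat, diagMat, Matrix.one_apply, h]

lemma selMat_conjTranspose_mul_diagMat (σ : Fin m → Fin d) (x : Fin d → ℝ) :
    (selMat σ)ᴴ * diagMat x = diagMat (x ∘ σ) * (selMat σ)ᴴ := by
  have := congrArg Matrix.conjTranspose (diagMat_mul_selMat σ x)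
  simpa only [Matrix.conjTranspose_mul, (isHermitian_diagMat _).eq] using this

lemma embMat_conjTranspose (σ : Fin m → Fin d) (w : Matrix (Fin m) (Fin m) ℂ) :
    (embMat σ w)ᴴ = embMat σ wᴴ := by
  simp [embMat, Matrix.mul_assoc]

lemma embMat_mul {σ : Fin m → Fin d} (hσ : Function.Injective σ)
    (w v : Matrix (Fin m) (Fin m) ℂ) : embMat σ w * embMat σ v = embMat σ (w * v) := by
  have h : selMat σ * (w - 1) * (selMat σ)ᴴ * (selMat σ * (v - 1) * (selMat σ)ᴴ)
      = selMat σ * ((w - 1) * (v - 1)) * (selMat σ)ᴴ := by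
    calc _ = selMat σ * (w - 1) * ((selMat σ)ᴴ * selMat σ) * (v - 1) * (selMat σ)ᴴ := by
          simp only [Matrix.mul_assoc]
      _ = _ := by rw [selMat_conjTranspose_mul hσ]; simp only [Matrix.mul_assoc, Matrix.one_mul]
  have h2 : w * v - 1 = (w - 1) + (v - 1) + (w - 1) * (v - 1) := by noncomm_ring
  simp only [embMat]
  rw [add_mul, mul_add, mul_add, h, h2]
  simp only [Matrix.mul_add, Matrix.add_mul, one_mul, mul_one]
  abel

lemma embMat_one (σ : Fin m → Fin d) : embMat σ 1 = 1 := by simp [embMat]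

lemma embMat_mem_unitaryGroup {σ : Fin m → Fin d} (hσ : Function.Injective σ)
    {w : Matrix (Fin m) (Fin m) ℂ} (hw : w ∈ Matrix.unitaryGroup (Fin m) ℂ) :
    embMat σ w ∈ Matrix.unitaryGroup (Fin d) ℂ := by
  rw [Matrix.mem_unitaryGroup_iff, Matrix.star_eq_conjTranspose] at *
  rw [embMat_conjTranspose, embMat_mul hσ, hw, embMat_one]

/-- The isometry `selMat σ` intertwines `diagMat x` with its block on the selected coordinates, so
conjugation alters only that block. -/
lemma embMat_conj_diagMat {σ : Fin m → Fin d} (hσ : Function.Injective σ)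
    (w : Matrix (Fin m) (Fin m) ℂ) (x : Fin d → ℝ) :
    (embMat σ w)ᴴ * diagMat x * embMat σ w
      = diagMat x + selMat σ * (wᴴ * diagMat (x ∘ σ) * w - diagMat (x ∘ σ)) * (selMat σ)ᴴ := by
  set δ := diagMat (x ∘ σ)
  set T := selMat σ
  have hT : Tᴴ * T = 1 := selMat_conjTranspose_mul hσ
  have h1 : diagMat x * T = T * δ := diagMat_mul_selMat σ x
  have h2 : Tᴴ * diagMat x = δ * Tᴴ := selMat_conjTranspose_mul_diagMat σ x
  have e1 : diagMat x * embMat σ w = diagMat x + T * (δ * (w - 1)) * Tᴴ := by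
    rw [embMat, mul_add, mul_one, ← Matrix.mul_assoc, ← Matrix.mul_assoc, h1]
    simp only [Matrix.mul_assoc]
    rfl
  have e2 : T * (wᴴ - 1) * Tᴴ * (T * (δ * (w - 1)) * Tᴴ)
      = T * ((wᴴ - 1) * (δ * (w - 1))) * Tᴴ := by
    calc _ = T * (wᴴ - 1) * (Tᴴ * T) * (δ * (w - 1)) * Tᴴ := by simp only [Matrix.mul_assoc]
      _ = _ := by rw [hT]; simp only [Matrix.mul_assoc, Matrix.one_mul]
  have e3 : T * (wᴴ - 1) * Tᴴ * diagMat x = T * ((wᴴ - 1) * δ) * Tᴴ := by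
    rw [Matrix.mul_assoc _ Tᴴ, h2]; simp only [Matrix.mul_assoc]
  have e4 : wᴴ * δ * w - δ = δ * (w - 1) + (wᴴ - 1) * δ + (wᴴ - 1) * (δ * (w - 1)) := by
    noncomm_ring
  rw [Matrix.mul_assoc, e1, embMat_conjTranspose]
  simp only [embMat]
  rw [add_mul, mul_add, one_mul, one_mul, mul_add, e2, e3, e4]
  simp only [Matrix.mul_add, Matrix.add_mul]
  abel

lemma diagMat_conj_add (σ : Fin m → Fin d) (g x : Fin d → ℝ) (w : Matrix (Fin m) (Fin m) ℂ) :
    diagMat g * (diagMat x + selMat σ * w * (selMat σ)ᴴ) * diagMat g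
      = diagMat (g * x * g)
        + selMat σ * (diagMat (g ∘ σ) * w * diagMat (g ∘ σ)) * (selMat σ)ᴴ := by
  have h0 : diagMat (g * x * g) = diagMat g * diagMat x * diagMat g := by simp [diagMat]
  rw [mul_add, add_mul, h0]
  congr 1
  calc _ = (diagMat g * selMat σ) * w * ((selMat σ)ᴴ * diagMat g) := by
        simp only [Matrix.mul_assoc]
    _ = _ := by
        rw [diagMat_mul_selMat, selMat_conjTranspose_mul_diagMat]; simp only [Matrix.mul_assoc]

/-- Replacing selected diagonal entries has the same form of block correction as a conjugation by
`embMat`; this lets a perturbed block be rediagonalized inside the full matrix. -/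
lemma diagMat_extend {σ : Fin m → Fin d} (hσ : Function.Injective σ) (y : Fin m → ℝ)
    (x : Fin d → ℝ) :
    diagMat (Function.extend σ y x)
      = diagMat x + selMat σ * (diagMat y - diagMat (x ∘ σ)) * (selMat σ)ᴴ := by
  have h : diagMat y - diagMat (x ∘ σ) = diagMat (y - x ∘ σ) := by simp [diagMat]
  have key : ∀ k l, (selMat σ * diagMat (y - x ∘ σ) * (selMat σ)ᴴ) k l
      = ∑ a, if k = σ a ∧ l = σ a then ((y a - x (σ a) : ℝ) : ℂ) else 0 := by
    intro k l
    rw [Matrix.mul_apply]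
    refine Finset.sum_congr rfl fun a _ => ?_
    by_cases h1 : k = σ a <;> by_cases h2 : l = σ a <;>
      simp [selMat, diagMat, Matrix.one_apply, h1, h2]
  rw [h]
  ext k l
  rw [Matrix.add_apply, key]
  by_cases hk : ∃ a, σ a = k
  · obtain ⟨b, rfl⟩ := hk
    by_cases hl : σ b = l
    · subst hl
      simp [diagMat, hσ.eq_iff, hσ.extend_apply]
    · have : ∀ a, ¬ (σ b = σ a ∧ l = σ a) := fun a ⟨h1, h2⟩ => hl (h1.trans h2.symm)
      simp [diagMat, hl, this]
  · have : ∀ a, ¬ (k = σ a ∧ l = σ a) := fun a ⟨h1, _⟩ => hk ⟨a, h1.symm⟩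
    simp [this, diagMat, Matrix.diagonal, Function.extend_apply' _ _ _ hk]

end Embedding

/-! ### Oppositely ordered spectra are not locally optimal. -/

section Rotation

variable {d m : ℕ} {N : Seminorm ℂ (Matrix (Fin d) (Fin d) ℂ)}

/-- The effect on `logDist` of changing only the coordinates in the range of `σ`. -/
lemma logDist_embMat_conj (hinv : IsUnitarilyInvariant N) {U : Matrix (Fin d) (Fin d) ℂ}
    (hU : U ∈ Matrix.unitaryGroup (Fin d) ℂ) {a : Fin d → ℝ} (ha : ∀ i, 0 < a i)
    (c : Fin d → ℝ) {σ : Fin m → Fin d} (hσ : Function.Injective σ)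
    (r : Matrix (Fin m) (Fin m) ℂ)
    (hP : (diagMat ((fun i => (√(a i))⁻¹) ∘ σ) * (rᴴ * diagMat (c ∘ σ) * r) *
      diagMat ((fun i => (√(a i))⁻¹) ∘ σ)).IsHermitian) :
    logDist N (diagAlgHom U hU a)
        (U * ((embMat σ r)ᴴ * diagMat c * embMat σ r) * Uᴴ)
      = N (diagMat fun i =>
          Real.log (Function.extend σ hP.eigenvalues (fun i => c i / a i) i)) := by
  set g : Fin d → ℝ := fun i => (√(a i))⁻¹ with hg
  obtain ⟨w, hw, hPw⟩ := exists_eq_diagAlgHom hP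
  set μ := hP.eigenvalues
  have hU' : Uᴴ * U = 1 := Matrix.mem_unitaryGroup_iff'.mp hU
  have hgc : g * c * g = fun i => c i / a i := by
    funext i
    have := Real.mul_self_sqrt (ha i).le
    have h0 : √(a i) ≠ 0 := (Real.sqrt_pos.mpr (ha i)).ne'
    simp only [Pi.mul_apply, hg]
    nth_rewrite 3 [← this]
    field_simp
  set x := Function.extend σ μ (fun i => c i / a i) with hx
  have hxσ : x ∘ σ = μ := by
    funext b
    rw [Function.comp_apply, hx]
    exact hσ.extend_apply μ _ b
  have hgcσ : diagMat (g ∘ σ) * diagMat (c ∘ σ) * diagMat (g ∘ σ)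
      = diagMat ((fun i => c i / a i) ∘ σ) := by
    rw [← hgc]
    simp [diagMat]
  have hwu : embMat σ w ∈ Matrix.unitaryGroup (Fin d) ℂ := embMat_mem_unitaryGroup hσ hw
  -- Off the selected coordinates the matrix is still diagonal with entries c i / a i, and its
  -- selected block is diagonalized by w.
  have key : diagMat g * ((embMat σ r)ᴴ * diagMat c * embMat σ r) * diagMat g
      = embMat σ w * diagMat x * (embMat σ w)ᴴ := by
    have h2 := embMat_conj_diagMat hσ wᴴ x
    rw [embMat_conjTranspose, Matrix.conjTranspose_conjTranspose, hxσ] at h2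
    rw [embMat_conjTranspose σ w, h2, embMat_conj_diagMat hσ, diagMat_conj_add, hgc,
      hx, diagMat_extend hσ, add_assoc, ← Matrix.add_mul, ← Matrix.mul_add, mul_sub, sub_mul, hPw,
      diagAlgHom_apply, hgcσ]
    congr 4
    abel
  have hM : invSqrt (diagAlgHom U hU a) * (U * ((embMat σ r)ᴴ * diagMat c * embMat σ r) * Uᴴ)
      * invSqrt (diagAlgHom U hU a) = diagAlgHom (U * embMat σ w) (mul_mem hU hwu) x := by
    rw [invSqrt_diagAlgHom, diagAlgHom_apply, diagAlgHom_apply]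
    calc _ = U * (diagMat g * (Uᴴ * U) * ((embMat σ r)ᴴ * diagMat c * embMat σ r) * (Uᴴ * U)
              * diagMat g) * Uᴴ := by simp only [mul_assoc]; rfl
      _ = U * (embMat σ w * diagMat x * (embMat σ w)ᴴ) * Uᴴ := by
          rw [hU', mul_one, mul_one, key]
      _ = _ := by simp only [Matrix.conjTranspose_mul, mul_assoc]
  rw [logDist, hM, logm_diagAlgHom, hinv.diagAlgHom]

/-- The rotation of angle `θ`. -/
noncomputable def rotMat (θ : ℝ) : Matrix (Fin 2) (Fin 2) ℂ :=
  !![(Real.cos θ : ℂ), -(Real.sin θ : ℂ); (Real.sin θ : ℂ), (Real.cos θ : ℂ)]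

lemma rotMat_conjTranspose (θ : ℝ) :
    (rotMat θ)ᴴ = !![(Real.cos θ : ℂ), (Real.sin θ : ℂ); -(Real.sin θ : ℂ), (Real.cos θ : ℂ)] := by
  ext i j
  fin_cases i <;> fin_cases j <;> simp [rotMat, -Complex.ofReal_cos, -Complex.ofReal_sin]

lemma rotMat_mem_unitaryGroup (θ : ℝ) : rotMat θ ∈ Matrix.unitaryGroup (Fin 2) ℂ := by
  have h : (Real.cos θ : ℂ) * Real.cos θ + Real.sin θ * Real.sin θ = 1 := by
    have := Real.cos_sq_add_sin_sq θ
    exact_mod_cast by nlinarith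
  have h' : (Real.sin θ : ℂ) * Real.sin θ + Real.cos θ * Real.cos θ = 1 := by rw [add_comm, h]
  rw [Matrix.mem_unitaryGroup_iff, Matrix.star_eq_conjTranspose, rotMat_conjTranspose, rotMat]
  ext i j
  fin_cases i <;> fin_cases j <;>
    simp [Matrix.mul_apply, -Complex.ofReal_cos, -Complex.ofReal_sin, h, h', mul_comm]

/-- Since uv = pq, one has (u − p)(u − q) = u(u + v − p − q) < 0. -/
lemma lt_and_lt_of_mul_eq_of_add_lt {p q u v : ℝ} (hp : 0 < u) (hmul : u * v = p * q)
    (hadd : u + v < p + q) (hpq : p < q) : p < u ∧ u < q := by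
  have h : (u - p) * (u - q) < 0 := by nlinarith
  rcases mul_neg_iff.mp h with ⟨h1, h2⟩ | ⟨h1, h2⟩
  · exact ⟨by linarith, by linarith⟩
  · linarith

/-- If `a` and `c` are not sorted alike, a small rotation decreases the distance. -/
lemma logDist_rotMat_lt (hN : IsNorm N) (hinv : IsUnitarilyInvariant N)
    (hconv : IsStrictlyConvexOnDiagonals N) {U : Matrix (Fin d) (Fin d) ℂ}
    (hU : U ∈ Matrix.unitaryGroup (Fin d) ℂ) {a c : Fin d → ℝ} (ha : ∀ i, 0 < a i)
    (hc : ∀ i, 0 < c i) {i j : Fin d} (haij : a j < a i) (hcij : c i < c j) {θ : ℝ}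
    (hθ : Real.sin θ ≠ 0) :
    logDist N (diagAlgHom U hU a)
        (U * ((embMat ![i, j] (rotMat θ))ᴴ * diagMat c * embMat ![i, j] (rotMat θ)) * Uᴴ)
      < logDist N (diagAlgHom U hU a) (diagAlgHom U hU c) := by
  have hij : i ≠ j := fun h => by subst h; exact lt_irrefl _ haij
  set σ : Fin 2 → Fin d := ![i, j] with hσdef
  have hσ : Function.Injective σ := by
    intro x y hxy
    fin_cases x <;> fin_cases y <;> simp_all [σ]
  set g : Fin d → ℝ := fun k => (√(a k))⁻¹ with hg
  have hgpos : ∀ k, 0 < g k := fun k => inv_pos.mpr (Real.sqrt_pos.mpr (ha k))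
  have hg2 : ∀ k, g k * g k = (a k)⁻¹ := fun k => by
    rw [hg, ← mul_inv, Real.mul_self_sqrt (ha k).le]
  set P := diagMat (g ∘ σ) * ((rotMat θ)ᴴ * diagMat (c ∘ σ) * rotMat θ) * diagMat (g ∘ σ)
    with hPdef
  have hru := rotMat_mem_unitaryGroup θ
  have hrr : (rotMat θ)ᴴ * rotMat θ = 1 := Matrix.mem_unitaryGroup_iff'.mp hru
  have hPpos : P.PosDef := by
    have h1 := Matrix.PosDef.diagonal (d := fun k => (((c ∘ σ) k : ℝ) : ℂ))
      (fun k => by simpa using hc (σ k))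
    have h2 := h1.conjTranspose_mul_mul_same (B := rotMat θ)
      (Matrix.mulVec_injective_of_isUnit (IsUnit.of_mul_eq_one_right _ hrr))
    have h3 := h2.conjTranspose_mul_mul_same (B := diagMat (g ∘ σ))
      (Matrix.mulVec_injective_of_isUnit (by
        refine (Matrix.isUnit_iff_isUnit_det _).mpr ?_
        rw [diagMat, Matrix.det_diagonal, isUnit_iff_ne_zero, Finset.prod_ne_zero_iff]
        intro k _
        exact_mod_cast (hgpos (σ k)).ne'))
    rw [(isHermitian_diagMat _).eq] at h3
    exact h3
  have hP := hPpos.isHermitian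
  set μ := hP.eigenvalues with hμ
  have hμpos : ∀ k, 0 < μ k := hPpos.eigenvalues_pos
  set s := Real.sin θ
  set k := Real.cos θ
  have hks : k ^ 2 + s ^ 2 = 1 := Real.cos_sq_add_sin_sq θ
  have hdet : μ 0 * μ 1 = (c i / a i) * (c j / a j) := by
    have h1 := hP.det_eq_prod_eigenvalues
    have hd : (rotMat θ)ᴴ.det * (rotMat θ).det = 1 := by rw [← Matrix.det_mul, hrr, Matrix.det_one]
    have hPd : P.det = _ := congrArg Matrix.det hPdef
    rw [hPd] at h1
    simp only [Matrix.det_mul, diagMat, Matrix.det_diagonal, Fin.prod_univ_two] at h1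
    have h2 : ((μ 0 * μ 1 : ℝ) : ℂ) = ((g i * g i * (g j * g j) * (c i * c j) : ℝ) : ℂ) := by
      push_cast
      simp only [RCLike.ofReal_eq_complex_ofReal] at h1
      rw [← h1]
      simp only [σ, Function.comp_apply, Matrix.cons_val_zero, Matrix.cons_val_one]
      linear_combination (g i * g i * (g j * g j) * (c i * c j) : ℂ) * hd
    have h3 := Complex.ofReal_injective h2
    rw [h3, hg2, hg2]
    field_simp
  have htr : μ 0 + μ 1 = (c i * k ^ 2 + c j * s ^ 2) / a i + (c i * s ^ 2 + c j * k ^ 2) / a j := by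
    have h1 := hP.trace_eq_sum_eigenvalues
    have h2 : ((μ 0 + μ 1 : ℝ) : ℂ) = ((g i * g i * (c i * k ^ 2 + c j * s ^ 2)
        + g j * g j * (c i * s ^ 2 + c j * k ^ 2) : ℝ) : ℂ) := by
      rw [Fin.sum_univ_two] at h1
      simp only [RCLike.ofReal_eq_complex_ofReal] at h1
      push_cast
      have hδ : ∀ x : Fin 2 → ℝ, diagMat x = !![(x 0 : ℂ), 0; 0, (x 1 : ℂ)] := by
        intro x
        ext u v
        fin_cases u <;> fin_cases v <;> simp [diagMat]
      rw [← h1, hPdef, rotMat_conjTranspose, rotMat, hδ, hδ]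
      simp [Matrix.trace_fin_two, σ, s, k,
        -Complex.ofReal_cos, -Complex.ofReal_sin]
      ring
    have h3 := Complex.ofReal_injective h2
    rw [h3, hg2, hg2]
    field_simp
  -- The trace falls by sin²θ (c j − c i)(1/a j − 1/a i), a product of positive factors.
  have hlt : μ 0 + μ 1 < c i / a i + c j / a j := by
    have hs : 0 < s ^ 2 := by positivity
    have hinvlt : (a i)⁻¹ < (a j)⁻¹ := inv_strictAnti₀ (ha j) haij
    have : c i / a i + c j / a j - (μ 0 + μ 1)
        = s ^ 2 * ((c j - c i) * ((a j)⁻¹ - (a i)⁻¹)) := by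
      rw [htr, show k ^ 2 = 1 - s ^ 2 by linarith]
      field_simp
      ring
    have h2 : 0 < s ^ 2 * ((c j - c i) * ((a j)⁻¹ - (a i)⁻¹)) :=
      mul_pos hs (mul_pos (sub_pos.mpr hcij) (sub_pos.mpr hinvlt))
    linarith
  have hpi : 0 < c i / a i := div_pos (hc i) (ha i)
  have hpj : 0 < c j / a j := div_pos (hc j) (ha j)
  have hpq : c i / a i < c j / a j := div_lt_div₀ hcij haij.le (hc j).le (ha j)
  obtain ⟨hlo, hhi⟩ := lt_and_lt_of_mul_eq_of_add_lt (hμpos 0) hdet hlt hpq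
  set l : Fin d → ℝ := fun k => Real.log (c k / a k) with hl
  have hlogsum : Real.log (μ 0) + Real.log (μ 1) = l i + l j := by
    rw [← Real.log_mul (hμpos 0).ne' (hμpos 1).ne', hdet, Real.log_mul hpi.ne' hpj.ne']
  have hl1 : l i < Real.log (μ 0) := Real.log_lt_log hpi hlo
  have hl2 : Real.log (μ 0) < l j := Real.log_lt_log (hμpos 0) hhi
  have hlij : 0 < l j - l i := by linarith
  -- The new logarithms have the same sum as l i and l j and lie strictly between them, so the new
  -- vector is a proper convex combination of l and its transposition, which have equal norm.
  set t := (Real.log (μ 0) - l i) / (l j - l i) with ht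
  have ht0 : 0 < t := div_pos (by linarith) hlij
  have ht1 : t < 1 := (div_lt_one hlij).mpr (by linarith)
  have htmul : t * (l j - l i) = Real.log (μ 0) - l i := div_mul_cancel₀ _ hlij.ne'
  rw [logDist_embMat_conj hinv hU ha c hσ (rotMat θ) hP, logDist_diagAlgHom hinv hU ha]
  have hvec : (fun k => Real.log (Function.extend σ μ (fun i => c i / a i) k))
      = (1 - t) • l + t • (l ∘ Equiv.swap i j) := by
    funext k
    simp only [Pi.add_apply, Pi.smul_apply, smul_eq_mul, Function.comp_apply]
    by_cases hki : k = i
    · subst hki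
      have : Function.extend σ μ (fun i => c i / a i) k = μ 0 := hσ.extend_apply μ _ 0
      rw [this, Equiv.swap_apply_left]
      linarith
    by_cases hkj : k = j
    · subst hkj
      have : Function.extend σ μ (fun i => c i / a i) k = μ 1 := hσ.extend_apply μ _ 1
      rw [this, Equiv.swap_apply_right]
      linarith
    have hne : ¬ ∃ b, σ b = k := by
      rintro ⟨b, rfl⟩
      fin_cases b
      · exact hki rfl
      · exact hkj rfl
    rw [Function.extend_apply' _ _ _ hne, Equiv.swap_apply_of_ne_of_ne hki hkj]
    simp only [hl]
    ring
  rw [hvec]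
  refine hconv.lt hN (fun h => ?_) (hinv.diagMat_comp_perm l _).le ht0 ht1
  have := congrFun h i
  simp only [Function.comp_apply, Equiv.swap_apply_left] at this
  linarith

/-- Otherwise the rotations of angle θ → 0⁺ give points of the orbit tending to the minimizer with
strictly smaller distance. -/
lemma IsLocalMinOn.not_reversed (hN : IsNorm N) (hinv : IsUnitarilyInvariant N)
    (hconv : IsStrictlyConvexOnDiagonals N) {B : Matrix (Fin d) (Fin d) ℂ}
    {U : Matrix (Fin d) (Fin d) ℂ}
    (hU : U ∈ Matrix.unitaryGroup (Fin d) ℂ) {a c : Fin d → ℝ} (ha : ∀ i, 0 < a i)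
    (hc : ∀ i, 0 < c i) (hC : diagAlgHom U hU c ∈ unitaryOrbit B)
    (hmin : IsLocalMinOn (logDist N (diagAlgHom U hU a)) (unitaryOrbit B) (diagAlgHom U hU c))
    {i j : Fin d} (haij : a j < a i) : c j ≤ c i := by
  by_contra! hcij
  have hij : i ≠ j := fun h => by subst h; exact lt_irrefl _ haij
  set σ : Fin 2 → Fin d := ![i, j] with hσdef
  have hσ : Function.Injective σ := by
    intro x y hxy
    fin_cases x <;> fin_cases y <;> simp_all [σ]
  have hU' : Uᴴ * U = 1 := Matrix.mem_unitaryGroup_iff'.mp hU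
  set γ : ℝ → Matrix (Fin d) (Fin d) ℂ := fun θ =>
    U * ((embMat σ (rotMat θ))ᴴ * diagMat c * embMat σ (rotMat θ)) * Uᴴ with hγ
  have hγ0 : γ 0 = diagAlgHom U hU c := by
    have : rotMat 0 = 1 := by
      ext x y
      fin_cases x <;> fin_cases y <;> simp [rotMat]
    simp [hγ, this, embMat_one, diagAlgHom_apply]
  have hrc : Continuous rotMat := by
    unfold rotMat
    refine continuous_matrix fun x y => ?_
    fin_cases x <;> fin_cases y <;> simp <;> fun_prop
  have hec : Continuous fun θ => embMat σ (rotMat θ) :=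
    continuous_const.add ((continuous_const.matrix_mul (hrc.sub continuous_const)).matrix_mul
      continuous_const)
  have hcont : Continuous γ :=
    (continuous_const.matrix_mul
      ((hec.matrix_conjTranspose.matrix_mul continuous_const).matrix_mul hec)).matrix_mul
        continuous_const
  have hmem : ∀ θ, γ θ ∈ unitaryOrbit B := by
    intro θ
    have he := embMat_mem_unitaryGroup hσ (rotMat_mem_unitaryGroup θ)
    have h := mem_unitaryOrbit_conj hC
      (mul_mem (mul_mem hU he) (Unitary.star_mem hU))
    have heq : γ θ = (U * embMat σ (rotMat θ) * Uᴴ)ᴴ * diagAlgHom U hU c *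
        (U * embMat σ (rotMat θ) * Uᴴ) := by
      calc γ θ = U * ((embMat σ (rotMat θ))ᴴ * 1 * diagMat c * 1 * embMat σ (rotMat θ)) * Uᴴ := by
            simp only [mul_one, hγ]
        _ = _ := by
            rw [← hU', diagAlgHom_apply]
            simp only [Matrix.conjTranspose_mul, Matrix.conjTranspose_conjTranspose, mul_assoc]
    rw [heq]
    exact h
  have htend : Filter.Tendsto γ (nhds 0) (nhdsWithin (diagAlgHom U hU c) (unitaryOrbit B)) := by
    rw [← hγ0]
    exact tendsto_nhdsWithin_iff.mpr
      ⟨hcont.tendsto 0, Filter.Eventually.of_forall hmem⟩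
  have hev := htend.eventually hmin
  have hev2 : ∀ᶠ θ in nhdsWithin (0 : ℝ) (Set.Ioi 0), Real.sin θ ≠ 0 := by
    filter_upwards [Ioo_mem_nhdsGT Real.pi_pos] with θ hθ
    exact (Real.sin_pos_of_pos_of_lt_pi hθ.1 hθ.2).ne'
  obtain ⟨θ, h1, h2⟩ := ((hev.filter_mono nhdsWithin_le_nhds).and hev2).exists
  exact absurd (logDist_rotMat_lt hN hinv hconv hU ha hc haij hcij h2) (not_lt.mpr h1)

/-- A simultaneous diagonalization may be chosen lexicographically non-increasing. -/
lemma exists_sorted_diagAlgHom {U : Matrix (Fin d) (Fin d) ℂ}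
    (hU : U ∈ Matrix.unitaryGroup (Fin d) ℂ) (a c : Fin d → ℝ) :
    ∃ (V : Matrix (Fin d) (Fin d) ℂ) (hV : V ∈ Matrix.unitaryGroup (Fin d) ℂ) (a' c' : Fin d → ℝ),
      diagAlgHom U hU a = diagAlgHom V hV a' ∧ diagAlgHom U hU c = diagAlgHom V hV c' ∧
      ∀ i j, i ≤ j → a' j ≤ a' i ∧ (a' i = a' j → c' j ≤ c' i) := by
  -- The signs turn the increasing order of `Tuple.sort` into a non-increasing one.
  set f : Fin d → ℝ ×ₗ ℝ := fun i => toLex (-a i, -c i)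
  set σ := Tuple.sort f
  have hmono : Monotone (f ∘ σ) := Tuple.monotone_sort f
  set P : Matrix (Fin d) (Fin d) ℂ := (1 : Matrix (Fin d) (Fin d) ℂ).submatrix id σ with hP
  have hPh : Pᴴ = (1 : Matrix (Fin d) (Fin d) ℂ).submatrix σ id := by
    rw [hP, Matrix.conjTranspose_submatrix, Matrix.conjTranspose_one]
  have hmem : P ∈ Matrix.unitaryGroup (Fin d) ℂ := by
    rw [Matrix.mem_unitaryGroup_iff', Matrix.star_eq_conjTranspose, hPh, hP]
    ext i j
    simp [Matrix.mul_apply, Matrix.one_apply]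
  have hPP : P * Pᴴ = 1 := Matrix.mem_unitaryGroup_iff.mp hmem
  have key : ∀ x : Fin d → ℝ,
      diagAlgHom U hU x = diagAlgHom (U * P) (mul_mem hU hmem) (x ∘ σ) := by
    intro x
    have h1 : P * diagMat (x ∘ σ) * Pᴴ = diagMat x := by
      have : diagMat x * P = P * diagMat (x ∘ σ) := diagMat_mul_selMat σ x
      rw [← this, mul_assoc, hPP, mul_one]
    rw [diagAlgHom_apply, diagAlgHom_apply, ← h1]
    simp only [Matrix.conjTranspose_mul, mul_assoc]
  refine ⟨U * P, mul_mem hU hmem, a ∘ σ, c ∘ σ, key a, key c, fun i j hij => ?_⟩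
  have h := hmono hij
  simp only [Function.comp_apply, f, Prod.Lex.toLex_le_toLex] at h
  simp only [Function.comp_apply]
  rcases h with h | ⟨h, h'⟩
  · exact ⟨by linarith, fun he => by linarith⟩
  · exact ⟨by linarith, fun _ => by linarith⟩

/-- A local minimizer that commutes with `A` is diagonalized together with `A` in the same
order. -/
lemma IsLocalMinOn.exists_diagAlgHom_eigs (hN : IsNorm N) (hinv : IsUnitarilyInvariant N)
    (hconv : IsStrictlyConvexOnDiagonals N) {A B C : Matrix (Fin d) (Fin d) ℂ}
    (hA : A.PosDef) (hB : B.PosDef) (hC : C ∈ unitaryOrbit B)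
    (hmin : IsLocalMinOn (logDist N A) (unitaryOrbit B) C) (hAC : Commute A C) :
    ∃ (U : Matrix (Fin d) (Fin d) ℂ) (hU : U ∈ Matrix.unitaryGroup (Fin d) ℂ),
      A = diagAlgHom U hU (eigs hA.isHermitian) ∧ C = diagAlgHom U hU (eigs hB.isHermitian) := by
  obtain ⟨V, hV, hCV⟩ := id hC
  have hVV : V * Vᴴ = 1 := Matrix.mem_unitaryGroup_iff.mp hV
  have hVV' : Vᴴ * V = 1 := Matrix.mem_unitaryGroup_iff'.mp hV
  have hCpos : C.PosDef := by
    rw [hCV]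
    exact hB.conjTranspose_mul_mul_same
      (Matrix.mulVec_injective_of_isUnit (IsUnit.of_mul_eq_one_right _ hVV'))
  obtain ⟨U₀, hU₀, a₀, c₀, hA₀, hC₀⟩ :=
    exists_simultaneous_diagAlgHom hA.isHermitian hCpos.isHermitian hAC
  obtain ⟨U, hU, a, c, ha, hc, hsort⟩ := exists_sorted_diagAlgHom hU₀ a₀ c₀
  have hAa := hA₀.trans ha
  have hCc := hC₀.trans hc
  have hapos : ∀ i, 0 < a i := pos_of_posDef_diagAlgHom hU (hAa ▸ hA)
  have hcpos : ∀ i, 0 < c i := pos_of_posDef_diagAlgHom hU (hCc ▸ hCpos)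
  have haa : Antitone a := fun i j hij => (hsort i j hij).1
  have hca : Antitone c := by
    intro i j hij
    -- Minimality orders c only across strict drops of a; on ties of a the lexicographic choice of
    -- basis orders it.
    rcases (haa hij).lt_or_eq with h | h
    · rw [hAa, hCc] at hmin
      exact IsLocalMinOn.not_reversed hN hinv hconv hU hapos hcpos (hCc ▸ hC) hmin h
    · exact (hsort i j hij).2 h.symm
  have e1 : eigs hA.isHermitian = a :=
    eigs_eq_of_antitone _ haa (by rw [hAa, charpoly_diagAlgHom])
  have e2 : eigs hB.isHermitian = c := by
    refine eigs_eq_of_antitone _ hca ?_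
    rw [← charpoly_diagAlgHom hU, ← hCc, hCV, Matrix.charpoly_mul_comm, ← mul_assoc, hVV, one_mul]
  exact ⟨U, hU, by rw [e1, hAa], by rw [e2, hCc]⟩

end Rotation

/-! ### One-parameter groups of unitaries and derivatives of conjugations. -/

section Curves

open scoped Matrix.Norms.L2Operator

variable {d : ℕ}

lemma exp_smul_conjTranspose {X : Matrix (Fin d) (Fin d) ℂ} (hX : Xᴴ = -X) (t : ℝ) :
    (NormedSpace.exp (t • X))ᴴ = NormedSpace.exp (t • (-X)) := by
  rw [← Matrix.exp_conjTranspose, Matrix.conjTranspose_smul, hX, star_trivial]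

lemma exp_smul_mem_unitaryGroup {X : Matrix (Fin d) (Fin d) ℂ} (hX : Xᴴ = -X) (t : ℝ) :
    NormedSpace.exp (t • X) ∈ Matrix.unitaryGroup (Fin d) ℂ := by
  rw [Matrix.mem_unitaryGroup_iff, Matrix.star_eq_conjTranspose, exp_smul_conjTranspose hX,
    ← Matrix.exp_add_of_commute]
  · simp
  · exact ((Commute.refl X).neg_right.smul_left t).smul_right t

lemma hasDerivAt_exp_smul_zero (X : Matrix (Fin d) (Fin d) ℂ) :
    HasDerivAt (fun t : ℝ => NormedSpace.exp (t • X)) X 0 := by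
  simpa using hasDerivAt_exp_smul_const (𝕂 := ℝ) X 0

/-- A matrix commuting with a one-parameter group commutes with its generator. -/
lemma commute_of_commute_exp_smul {K X : Matrix (Fin d) (Fin d) ℂ}
    (h : ∀ t : ℝ, Commute K (NormedSpace.exp (t • X))) : Commute K X := by
  have h1 := (hasDerivAt_exp_smul_zero X).const_mul K
  have h2 := (hasDerivAt_exp_smul_zero X).mul_const K
  have h3 : (fun t : ℝ => K * NormedSpace.exp (t • X))
      = fun t : ℝ => NormedSpace.exp (t • X) * K := funext fun t => (h t).eq
  rw [h3] at h1
  exact h1.unique h2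

lemma hasDerivAt_exp_conj (X P : Matrix (Fin d) (Fin d) ℂ) {f : ℝ → Matrix (Fin d) (Fin d) ℂ}
    {f' : Matrix (Fin d) (Fin d) ℂ} (hf : HasDerivAt f f' 0) (hP : f 0 = P) :
    HasDerivAt (fun t : ℝ => NormedSpace.exp (t • (-X)) * f t * NormedSpace.exp (t • X))
      (f' + (P * X - X * P)) 0 := by
  have h := ((hasDerivAt_exp_smul_zero (-X)).mul hf).mul (hasDerivAt_exp_smul_zero X)
  convert! h using 1
  simp [hP]
  abel

lemma hasDerivAt_diagAlgHom {U : Matrix (Fin d) (Fin d) ℂ}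
    (hU : U ∈ Matrix.unitaryGroup (Fin d) ℂ) {v : ℝ → Fin d → ℝ} {v' : Fin d → ℝ}
    (hv : HasDerivAt v v' 0) :
    HasDerivAt (fun t => diagAlgHom U hU (v t)) (diagAlgHom U hU v') 0 :=
  (LinearMap.toContinuousLinearMap (diagAlgHom U hU).toLinearMap).hasFDerivAt.comp_hasDerivAt 0 hv

end Curves

/-! ### Averaging a Hermitian matrix over unitaries. -/

section Averaging

variable {d : ℕ}

open scoped Matrix.Norms.L2Operator in
lemma isCompact_closure_convexHull_conj (L : Matrix (Fin d) (Fin d) ℂ)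
    (Γ : Set (Matrix (Fin d) (Fin d) ℂ)) (hΓ : ∀ u ∈ Γ, u ∈ Matrix.unitaryGroup (Fin d) ℂ) :
    IsCompact (closure (convexHull ℝ ((fun u => u * L * uᴴ) '' Γ))) := by
  have hb : Bornology.IsBounded ((fun u => u * L * uᴴ) '' Γ) := by
    refine (Metric.isBounded_closedBall (x := (0 : Matrix (Fin d) (Fin d) ℂ)) (r := ‖L‖)).subset ?_
    rintro _ ⟨u, hu, rfl⟩
    rw [mem_closedBall_zero_iff]
    exact (CStarRing.norm_mul_mem_unitary _ (Unitary.star_mem (hΓ u hu))).trans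
      (CStarRing.norm_mem_unitary_mul L (hΓ u hu)) |>.le
  exact (isBounded_convexHull.mpr hb).isCompact_closure

/-- The square of the Frobenius norm. -/
noncomputable def frobSq (X : Matrix (Fin d) (Fin d) ℂ) : ℝ := ((Xᴴ * X).trace).re

lemma frobSq_eq_sum (X : Matrix (Fin d) (Fin d) ℂ) :
    frobSq X = ∑ i, ∑ j, Complex.normSq (X j i) := by
  simp [frobSq, Matrix.trace, Matrix.mul_apply, Complex.normSq_apply]

lemma continuous_frobSq : Continuous (frobSq (d := d)) := by
  unfold frobSq
  fun_prop

lemma eq_zero_of_frobSq_nonpos {X : Matrix (Fin d) (Fin d) ℂ} (h : frobSq X ≤ 0) : X = 0 := by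
  rw [frobSq_eq_sum] at h
  have h0 : ∀ i ∈ Finset.univ, 0 ≤ ∑ j, Complex.normSq (X j i) := fun i _ =>
    Finset.sum_nonneg fun j _ => Complex.normSq_nonneg _
  have h1 := (Finset.sum_eq_zero_iff_of_nonneg h0).mp (le_antisymm h (Finset.sum_nonneg h0))
  ext j i
  have h2 := (Finset.sum_eq_zero_iff_of_nonneg
    fun j _ => Complex.normSq_nonneg (X j i)).mp (h1 i (Finset.mem_univ i)) j (Finset.mem_univ j)
  exact Complex.normSq_eq_zero.mp h2

lemma frobSq_conj {u : Matrix (Fin d) (Fin d) ℂ} (hu : u ∈ Matrix.unitaryGroup (Fin d) ℂ)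
    (X : Matrix (Fin d) (Fin d) ℂ) : frobSq (u * X * uᴴ) = frobSq X := by
  have hu' : uᴴ * u = 1 := Matrix.mem_unitaryGroup_iff'.mp hu
  have : (u * X * uᴴ)ᴴ * (u * X * uᴴ) = u * (Xᴴ * X) * uᴴ := by
    simp only [Matrix.conjTranspose_mul, Matrix.conjTranspose_conjTranspose]
    calc _ = u * Xᴴ * (uᴴ * u) * X * uᴴ := by simp only [mul_assoc]
      _ = _ := by rw [hu', mul_one]; simp only [mul_assoc]
  rw [frobSq, this, Matrix.trace_mul_comm, ← mul_assoc, hu', one_mul, frobSq]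

lemma frobSq_midpoint (X Y : Matrix (Fin d) (Fin d) ℂ) :
    frobSq ((1 / 2 : ℝ) • X + (1 / 2 : ℝ) • Y) + frobSq (X - Y) / 4
      = (frobSq X + frobSq Y) / 2 := by
  simp only [frobSq_eq_sum, Finset.sum_div, ← Finset.sum_add_distrib]
  refine Finset.sum_congr rfl fun i _ => Finset.sum_congr rfl fun j _ => ?_
  simp only [Matrix.add_apply, Matrix.smul_apply, Matrix.sub_apply, Complex.normSq_apply,
    Complex.add_re, Complex.add_im, Complex.sub_re, Complex.sub_im, Complex.real_smul,
    Complex.mul_re, Complex.mul_im, Complex.ofReal_re, Complex.ofReal_im]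
  ring

/-- The average of `L` over a group of unitaries, obtained as the element of smallest Frobenius
norm in the closed convex hull of the conjugates. -/
lemma exists_average (N : Seminorm ℂ (Matrix (Fin d) (Fin d) ℂ)) (hinv : IsUnitarilyInvariant N)
    {L : Matrix (Fin d) (Fin d) ℂ} (hL : L.IsHermitian)
    (Γ : Submonoid (Matrix (Fin d) (Fin d) ℂ)) (hΓ : Γ ≤ Matrix.unitaryGroup (Fin d) ℂ) :
    ∃ K : Matrix (Fin d) (Fin d) ℂ, K.IsHermitian ∧ N K ≤ N L ∧ (∀ u ∈ Γ, Commute K u) ∧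
      ∀ Z : Matrix (Fin d) (Fin d) ℂ, (∀ u ∈ Γ, Commute Z u) → (Z * K).trace = (Z * L).trace := by
  set H : Set (Matrix (Fin d) (Fin d) ℂ) := (fun u => u * L * uᴴ) '' Γ with hH
  set S := closure (convexHull ℝ H) with hS
  have hSc : IsCompact S := isCompact_closure_convexHull_conj L Γ fun u hu => hΓ hu
  have hLS : L ∈ S := subset_closure (subset_convexHull ℝ H ⟨1, Γ.one_mem, by simp⟩)
  have hSconv : Convex ℝ S := (convex_convexHull ℝ H).closure
  -- Any closed convex condition on K need only be checked on the conjugates of L.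
  have hmin : ∀ T : Set (Matrix (Fin d) (Fin d) ℂ), Convex ℝ T → IsClosed T →
      (∀ u ∈ Γ, u * L * uᴴ ∈ T) → S ⊆ T := by
    intro T hT hTc h
    refine closure_minimal (convexHull_min ?_ hT) hTc
    rintro _ ⟨u, hu, rfl⟩
    exact h u hu
  obtain ⟨K, hKS, hKmin⟩ := hSc.exists_isMinOn ⟨L, hLS⟩ continuous_frobSq.continuousOn
  have hu1 : ∀ u ∈ Γ, uᴴ * u = 1 := fun u hu => Matrix.mem_unitaryGroup_iff'.mp (hΓ hu)
  refine ⟨K, ?_, ?_, ?_, ?_⟩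
  · refine hmin {X | X.IsHermitian} ?_ ?_ ?_ hKS
    · intro X hX Y hY a b _ _ _
      have hX' : Xᴴ = X := hX
      have hY' : Yᴴ = Y := hY
      simp [Matrix.IsHermitian, hX', hY']
    · exact isClosed_eq (by fun_prop) continuous_id
    · intro u _
      exact Matrix.isHermitian_mul_mul_conjTranspose u hL
  · refine hmin {X | N X ≤ N L} ?_ ?_ ?_ hKS
    · simpa using (N.restrictScalars ℝ).convexOn.convex_le (N L)
    · exact isClosed_le (continuous_seminorm N) continuous_const
    · intro u hu
      exact (hinv.conj (hΓ hu) L).le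
  · intro u hu
    have hstable : u * K * uᴴ ∈ S := by
      refine hmin {X | u * X * uᴴ ∈ S} ?_ ?_ ?_ hKS
      · intro X hX Y hY a b ha hb hab
        have := hSconv hX hY ha hb hab
        simpa [mul_add, add_mul] using this
      · exact isClosed_closure.preimage (by fun_prop)
      · intro v hv
        refine subset_closure (subset_convexHull ℝ H ⟨u * v, Γ.mul_mem hu hv, ?_⟩)
        simp only [Matrix.conjTranspose_mul, mul_assoc]
    -- By the parallelogram law the midpoint of K and its conjugate, which has equal Frobenius norm,
    -- would be strictly smaller unless the two coincide.
    have hmid := hSconv hstable hKS (a := 1 / 2) (b := 1 / 2) (by norm_num) (by norm_num)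
      (by norm_num)
    have h1 := hKmin hmid
    have h2 := frobSq_midpoint (u * K * uᴴ) K
    rw [frobSq_conj (hΓ hu)] at h2
    have h1' : frobSq K ≤ frobSq ((1 / 2 : ℝ) • (u * K * uᴴ) + (1 / 2 : ℝ) • K) := h1
    have h3 := sub_eq_zero.mp (eq_zero_of_frobSq_nonpos (X := u * K * uᴴ - K) (by linarith))
    have h4 : u * K = K * u := by
      calc u * K = u * K * (uᴴ * u) := by rw [hu1 u hu, mul_one]
        _ = u * K * uᴴ * u := by simp only [mul_assoc]
        _ = K * u := by rw [h3]
    exact h4.symm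
  · intro Z hZ
    refine hmin {X | (Z * X).trace = (Z * L).trace} ?_ ?_ ?_ hKS
    · intro X hX Y hY a b _ _ hab
      have hX' : (Z * X).trace = (Z * L).trace := hX
      have hY' : (Z * Y).trace = (Z * L).trace := hY
      simp only [Set.mem_ofPred_eq, mul_add, Matrix.trace_add, Matrix.mul_smul, Matrix.trace_smul,
        hX', hY', ← add_smul, hab, one_smul]
    · exact isClosed_eq (by fun_prop) continuous_const
    · intro u hu
      show (Z * (u * L * uᴴ)).trace = (Z * L).trace
      have : Z * (u * L * uᴴ) = u * (Z * L) * uᴴ := by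
        rw [← mul_assoc, ← mul_assoc, (hZ u hu).eq]
        simp only [mul_assoc]
      rw [this, Matrix.trace_mul_comm, ← mul_assoc, hu1 u hu, one_mul]

/-- Averaging over the unitaries of the algebra generated by two Hermitian matrices. -/
lemma exists_commuting_average (N : Seminorm ℂ (Matrix (Fin d) (Fin d) ℂ))
    (hinv : IsUnitarilyInvariant N) {L A C : Matrix (Fin d) (Fin d) ℂ} (hL : L.IsHermitian)
    (hA : A.IsHermitian) (hC : C.IsHermitian) :
    ∃ K : Matrix (Fin d) (Fin d) ℂ, K.IsHermitian ∧ N K ≤ N L ∧ Commute K A ∧ Commute K C ∧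
      ∀ Z : Matrix (Fin d) (Fin d) ℂ, Commute Z A → Commute Z C →
        (Z * K).trace = (Z * L).trace := by
  -- These are the unitaries in the bicommutant of {A, C}; every Z in the commutant commutes with
  -- them by construction.
  set Γ : Submonoid (Matrix (Fin d) (Fin d) ℂ) :=
    Matrix.unitaryGroup (Fin d) ℂ ⊓ Submonoid.centralizer {Z | Commute Z A ∧ Commute Z C} with hΓ
  obtain ⟨K, hK, hKN, hKΓ, hKtr⟩ := exists_average N hinv hL Γ inf_le_left
  have hcomm : ∀ X : Matrix (Fin d) (Fin d) ℂ, X.IsHermitian →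
      (∀ Z, Commute Z A ∧ Commute Z C → Commute Z X) → Commute K X := by
    intro X hX hZ
    -- The unitaries exp(itX) lie in Γ, so K commutes with them and hence with their generator.
    have hskew : (Complex.I • X)ᴴ = -(Complex.I • X) := by
      rw [Matrix.conjTranspose_smul, hX.eq]; simp
    have h1 : Commute K (Complex.I • X) := by
      refine commute_of_commute_exp_smul fun t => hKΓ _ ⟨exp_smul_mem_unitaryGroup hskew t, ?_⟩
      refine Submonoid.mem_centralizer_iff.mpr fun Z hZmem => ?_
      exact ((((hZ Z hZmem).smul_right Complex.I).smul_right t).exp_right).eq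
    have h2 := h1.smul_right (-Complex.I)
    rwa [smul_smul, neg_mul, Complex.I_mul_I, neg_neg, one_smul] at h2
  refine ⟨K, hK, hKN, hcomm A hA fun Z hZ => hZ.1, hcomm C hC fun Z hZ => hZ.2,
    fun Z hZA hZC => hKtr Z fun u hu => ?_⟩
  exact Submonoid.mem_centralizer_iff.mp hu.2 Z ⟨hZA, hZC⟩

end Averaging

/-! ### Operator monotonicity and a Lipschitz bound for the logarithm. -/

section LogComparison

open scoped Matrix.Norms.L2Operator MatrixOrder

variable {d : ℕ}

/-- The shift X + r lies between 0 and 2r, where order controls the norm; undoing the shift costs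
another r. The sharp constant 1 is not needed. -/
lemma norm_le_three_mul {X : Matrix (Fin d) (Fin d) ℂ} {r : ℝ} (hr : 0 ≤ r)
    (h1 : -algebraMap ℝ (Matrix (Fin d) (Fin d) ℂ) r ≤ X)
    (h2 : X ≤ algebraMap ℝ (Matrix (Fin d) (Fin d) ℂ) r) : ‖X‖ ≤ 3 * r := by
  set e := algebraMap ℝ (Matrix (Fin d) (Fin d) ℂ) r with he
  have h0 : 0 ≤ e := by
    have h := h1.trans h2
    have h3 : (0 : Matrix (Fin d) (Fin d) ℂ) ≤ (2 : ℝ) • e := by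
      rw [two_smul]; exact neg_le_iff_add_nonneg.mp h
    have h4 := smul_nonneg (by norm_num : (0 : ℝ) ≤ 1 / 2) h3
    rwa [smul_smul, show (1 / 2 : ℝ) * 2 = 1 by norm_num, one_smul] at h4
  have h3 : ‖e‖ ≤ r := (CStarAlgebra.norm_le_iff_le_algebraMap e hr h0).mpr le_rfl
  have h4 : 0 ≤ X + e := neg_le_iff_add_nonneg.mp h1
  have h5 : ‖X + e‖ ≤ 2 * r := by
    refine (CStarAlgebra.norm_le_iff_le_algebraMap _ (by positivity) h4).mpr ?_
    rw [two_mul, map_add]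
    exact add_le_add_left h2 e
  calc ‖X‖ = ‖(X + e) - e‖ := by rw [add_sub_cancel_right]
    _ ≤ ‖X + e‖ + ‖e‖ := norm_sub_le _ _
    _ ≤ 3 * r := by linarith

/-- A local Lipschitz bound for the logarithm of positive definite matrices. -/
lemma norm_logm_sub_logm_le {P Q : Matrix (Fin d) (Fin d) ℂ} (hP : P.IsHermitian)
    (hQ : Q.IsHermitian) {c η : ℝ} (hc : 0 < c)
    (hcQ : algebraMap ℝ (Matrix (Fin d) (Fin d) ℂ) c ≤ Q) (hη : 0 ≤ η) (hη' : η ≤ 1 / 2)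
    (h : ‖P - Q‖ ≤ η * c) : ‖logm P - logm Q‖ ≤ 6 * η := by
  have hsa : IsSelfAdjoint (P - Q) := (hP.sub hQ).isSelfAdjoint
  have hmono : ∀ {x y : ℝ}, x ≤ y → algebraMap ℝ (Matrix (Fin d) (Fin d) ℂ) x ≤ algebraMap ℝ _ y :=
    fun hxy => algebraMap_mono _ hxy
  have hcpos : IsStrictlyPositive (algebraMap ℝ (Matrix (Fin d) (Fin d) ℂ) c) :=
    isStrictlyPositive_algebraMap hc
  have hQpos : IsStrictlyPositive Q := hcpos.of_le hcQ
  have hηQ : algebraMap ℝ (Matrix (Fin d) (Fin d) ℂ) ‖P - Q‖ ≤ η • Q := by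
    refine (hmono h).trans ?_
    rw [map_mul, ← Algebra.smul_def]
    exact smul_le_smul_of_nonneg_left hcQ hη
  -- The additive error is absorbed by Q ≥ c into (1 − η)Q ≤ P ≤ (1 + η)Q. Monotonicity of the
  -- logarithm then bounds log P − log Q between log(1 − η) and log(1 + η).
  have hup : P ≤ (1 + η) • Q := by
    have h1 := hsa.le_algebraMap_norm_self.trans hηQ
    rw [add_smul, one_smul]
    exact sub_le_iff_le_add'.mp h1
  have hlo : (1 - η) • Q ≤ P := by
    have h1 := (neg_le_neg hηQ).trans hsa.neg_algebraMap_norm_le_self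
    rw [sub_smul, one_smul, sub_eq_add_neg]
    exact le_sub_iff_add_le'.mp h1
  have hloQ : IsStrictlyPositive ((1 - η) • Q) := IsStrictlyPositive.smul (by linarith) hQpos
  have hPpos : IsStrictlyPositive P := hloQ.of_le hlo
  have l1 := CFC.log_le_log hup hPpos
  have l2 := CFC.log_le_log hlo hloQ
  rw [CFC.log_smul' Q (by linarith) hQpos] at l1 l2
  have e1 : Real.log (1 + η) ≤ 2 * η := by
    have := Real.log_le_sub_one_of_pos (show 0 < 1 + η by linarith)
    linarith
  have e2 : -(2 * η) ≤ Real.log (1 - η) := by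
    have hpos : 0 < 1 - η := by linarith
    have := Real.one_sub_inv_le_log_of_pos hpos
    have h3 : (1 - η)⁻¹ ≤ 1 + 2 * η := by
      rw [inv_le_iff_one_le_mul₀ hpos]
      nlinarith
    linarith
  have hfin : ‖CFC.log P - CFC.log Q‖ ≤ 3 * (2 * η) := by
    refine norm_le_three_mul (by positivity) ?_ ?_
    · rw [← map_neg]
      exact (hmono e2).trans (le_sub_iff_add_le.mpr l2)
    · exact (sub_le_iff_le_add.mpr l1).trans (hmono e1)
  have : logm P - logm Q = CFC.log P - CFC.log Q := rfl
  rw [this]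
  linarith

lemma algebraMap_le_diagAlgHom {U : Matrix (Fin d) (Fin d) ℂ}
    (hU : U ∈ Matrix.unitaryGroup (Fin d) ℂ) {x : Fin d → ℝ} {c : ℝ} (hx : ∀ i, c ≤ x i) :
    algebraMap ℝ (Matrix (Fin d) (Fin d) ℂ) c ≤ diagAlgHom U hU x := by
  rw [Matrix.le_iff, ← (diagAlgHom U hU).commutes c, ← map_sub]
  refine Matrix.PosSemidef.mul_mul_conjTranspose_same (Matrix.PosSemidef.diagonal ?_) U
  intro i
  have := hx i
  simpa using this

end LogComparison

/-! ### Solving for the tangent vectors by duality. -/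

section Tangent

variable {d : ℕ}

lemma exists_trace_eq_linearMap (f : Matrix (Fin d) (Fin d) ℂ →ₗ[ℂ] ℂ) :
    ∃ R : Matrix (Fin d) (Fin d) ℂ, ∀ X, f X = (R * X).trace := by
  refine ⟨Matrix.of fun i j => f (Matrix.single j i 1), fun X => ?_⟩
  conv_lhs => rw [Matrix.matrix_eq_sum_single X]
  simp only [map_sum, Matrix.trace, Matrix.mul_apply, Matrix.diag_apply, Matrix.of_apply]
  rw [Finset.sum_comm]
  refine Finset.sum_congr rfl fun j _ => Finset.sum_congr rfl fun i _ => ?_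
  have : Matrix.single i j (X i j) = X i j • Matrix.single i j (1 : ℂ) := by simp
  rw [this, map_smul, smul_eq_mul, mul_comm]

/-- If `K - L` is orthogonal to the commutant of `A` and `C`, then `M * (K - L)` is a tangent
vector at `M = A^{-1/2} C A^{-1/2}`, up to tangent vectors of the unitary orbit of `M`. -/
lemma exists_tangent_solution {A C G G' M L K : Matrix (Fin d) (Fin d) ℂ}
    (hGG' : G * G' = 1) (hA : G * G = A) (hM : M = G' * C * G')
    (hcommG : ∀ Z : Matrix (Fin d) (Fin d) ℂ, Commute Z A → Commute Z G)
    (hCunit : IsUnit C)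
    (htr : ∀ Z : Matrix (Fin d) (Fin d) ℂ, Commute Z A → Commute Z C →
      (Z * K).trace = (Z * L).trace) :
    ∃ X Y : Matrix (Fin d) (Fin d) ℂ,
      G' * (C * X - X * C) * G' + (Y * M - M * Y) = M * (K - L) := by
  have hG'G : G' * G = 1 := mul_eq_one_comm.mp hGG'
  have hMG : M * G = G' * C := by rw [hM, mul_assoc, hG'G, mul_one]
  let Φ : Matrix (Fin d) (Fin d) ℂ × Matrix (Fin d) (Fin d) ℂ →ₗ[ℂ] Matrix (Fin d) (Fin d) ℂ :=
    { toFun := fun p => G' * (C * p.1 - p.1 * C) * G' + (p.2 * M - M * p.2)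
      map_add' := fun p q => by simp only [Prod.fst_add, Prod.snd_add]; noncomm_ring
      map_smul' := fun r p => by
        simp only [Prod.smul_fst, Prod.smul_snd, mul_smul_comm, smul_mul_assoc, RingHom.id_apply,
          smul_add, smul_sub, mul_sub, sub_mul] }
  by_contra hcon
  have hnot : M * (K - L) ∉ LinearMap.range Φ := by
    rintro ⟨⟨X, Y⟩, h⟩
    exact hcon ⟨X, Y, h⟩
  -- A functional X ↦ tr(RX) vanishes on the range but not at M(K − L). Vanishing on the commutators
  -- with M makes R commute with M; vanishing on the other summand makes G'RG' commute with C.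
  obtain ⟨f, hf, hle⟩ := Submodule.exists_le_ker_of_notMem hnot
  obtain ⟨R, hR⟩ := exists_trace_eq_linearMap f
  have h0 : ∀ X Y, (R * (G' * (C * X - X * C) * G' + (Y * M - M * Y))).trace = 0 := by
    intro X Y
    rw [← hR]
    exact hle ⟨(X, Y), rfl⟩
  have hRM : M * R = R * M := by
    refine (Matrix.ext_iff_trace_mul_right).mpr fun Y => ?_
    have h := h0 0 Y
    simp only [mul_zero, zero_mul, sub_zero, zero_add, mul_sub, Matrix.trace_sub] at h
    rw [mul_assoc, Matrix.trace_mul_comm, mul_assoc, mul_assoc]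
    exact sub_eq_zero.mp h
  set S := G' * R * G' with hS
  have hSC : S * C = C * S := by
    refine (Matrix.ext_iff_trace_mul_right).mpr fun X => ?_
    have h := h0 X 0
    simp only [zero_mul, mul_zero, sub_zero, add_zero] at h
    have h1 : (R * (G' * (C * X - X * C) * G')).trace = (S * (C * X - X * C)).trace := by
      rw [hS, ← mul_assoc, Matrix.trace_mul_comm, ← mul_assoc]
      simp only [mul_assoc]
    rw [h1, mul_sub, Matrix.trace_sub] at h
    have h2 : (S * (X * C)).trace = (C * S * X).trace := by
      rw [← mul_assoc S X C, Matrix.trace_mul_comm (S * X) C, ← mul_assoc]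
    rw [mul_assoc, ← h2]
    exact sub_eq_zero.mp h
  -- The aim is that Z lies in the commutant of {A, C}, since tr(RM(K − L)) = tr(Z(K − L)). This is
  -- shown first for its conjugate W = G'ZG, which turns out to equal Z.
  set Z := R * M with hZ
  set W := G' * Z * G with hW
  have hWS : W = S * C := by rw [hW, hZ, hS, mul_assoc, mul_assoc, hMG]; simp only [mul_assoc]
  have hWC : W * C = C * W := by
    rw [hWS, hSC]
    rw [mul_assoc, hSC]
  have hZM : Z * M = M * Z := by
    conv_rhs => rw [hZ, ← mul_assoc, hRM]
  -- Z commutes with M, so W commutes with G'MG = G'G'C; it also commutes with the invertible C,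
  -- which can be cancelled.
  have hWGG : W * (G' * G') = (G' * G') * W := by
    have h1 : W * (G' * (M * G)) = (G' * (M * G)) * W := by
      calc W * (G' * (M * G)) = G' * Z * (G * G') * M * G := by rw [hW]; simp only [mul_assoc]
        _ = G' * (Z * M) * G := by rw [hGG']; simp only [mul_assoc, one_mul]
        _ = G' * (M * (G * G') * Z) * G := by rw [hZM, hGG', mul_one]
        _ = (G' * (M * G)) * W := by rw [hW]; simp only [mul_assoc]
    rw [hMG] at h1
    have h2 : W * (G' * G') * C = (G' * G') * W * C := by
      calc W * (G' * G') * C = W * (G' * (G' * C)) := by simp only [mul_assoc]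
        _ = (G' * G') * (C * W) := by rw [h1]; simp only [mul_assoc]
        _ = _ := by rw [← hWC]; simp only [mul_assoc]
    exact hCunit.mul_right_cancel h2
  have hinv1 : A * (G' * G') = 1 := by
    rw [← hA]
    calc G * G * (G' * G') = G * (G * G') * G' := by simp only [mul_assoc]
      _ = 1 := by rw [hGG', mul_one, hGG']
  have hinv2 : (G' * G') * A = 1 := mul_eq_one_comm.mp hinv1
  have hWA : Commute W A := by
    have : A * (W * (G' * G')) * A = A * ((G' * G') * W) * A := by rw [hWGG]
    have e1 : A * (W * (G' * G')) * A = A * W := by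
      rw [mul_assoc, mul_assoc W, hinv2, mul_one]
    have e2 : A * ((G' * G') * W) * A = W * A := by
      rw [← mul_assoc, hinv1, one_mul]
    rw [e1, e2] at this
    exact this.symm
  have hWZ : W = Z := by
    have h1 : G * W = Z * G := by
      rw [hW, ← mul_assoc, ← mul_assoc, hGG', one_mul]
    rw [← (hcommG W hWA).eq] at h1
    calc W = W * G * G' := by rw [mul_assoc, hGG', mul_one]
      _ = Z := by rw [h1, mul_assoc, hGG', mul_one]
  apply hf
  rw [hR, ← mul_assoc, ← hZ, mul_sub, Matrix.trace_sub, sub_eq_zero]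
  exact htr Z (hWZ ▸ hWA) (hWZ ▸ hWC)

/-- The tangent vectors of `exists_tangent_solution` may be taken skew-Hermitian. -/
lemma exists_skew_tangent_solution {A C G G' M L K : Matrix (Fin d) (Fin d) ℂ}
    (hGG' : G * G' = 1) (hA : G * G = A) (hM : M = G' * C * G')
    (hcommG : ∀ Z : Matrix (Fin d) (Fin d) ℂ, Commute Z A → Commute Z G)
    (hCunit : IsUnit C)
    (htr : ∀ Z : Matrix (Fin d) (Fin d) ℂ, Commute Z A → Commute Z C →
      (Z * K).trace = (Z * L).trace)
    (hC : C.IsHermitian) (hG' : G'.IsHermitian) (hMK : (M * (K - L)).IsHermitian) :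
    ∃ X Y : Matrix (Fin d) (Fin d) ℂ, Xᴴ = -X ∧ Yᴴ = -Y ∧
      G' * (C * X - X * C) * G' + (Y * M - M * Y) = M * (K - L) := by
  obtain ⟨X, Y, h⟩ := exists_tangent_solution hGG' hA hM hcommG hCunit htr
  have hMh : Mᴴ = M := by
    rw [hM]
    simp only [Matrix.conjTranspose_mul, hC.eq, hG'.eq, mul_assoc]
  have h' := congrArg Matrix.conjTranspose h
  rw [hMK.eq] at h'
  simp only [Matrix.conjTranspose_add, Matrix.conjTranspose_mul, Matrix.conjTranspose_sub,
    hC.eq, hG'.eq, hMh] at h'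
  -- The right-hand side being Hermitian, (−Xᴴ, −Yᴴ) is also a solution; the mean of the two
  -- solutions is skew-Hermitian.
  have hsum : G' * (C * (X - Xᴴ) - (X - Xᴴ) * C) * G' + ((Y - Yᴴ) * M - M * (Y - Yᴴ))
      = M * (K - L) + M * (K - L) := by
    nth_rewrite 1 [← h]
    rw [← h']
    noncomm_ring
  refine ⟨(1 / 2 : ℂ) • (X - Xᴴ), (1 / 2 : ℂ) • (Y - Yᴴ), ?_, ?_, ?_⟩
  · rw [Matrix.conjTranspose_smul, Matrix.conjTranspose_sub, Matrix.conjTranspose_conjTranspose,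
      ← smul_neg, neg_sub]
    simp
  · rw [Matrix.conjTranspose_smul, Matrix.conjTranspose_sub, Matrix.conjTranspose_conjTranspose,
      ← smul_neg, neg_sub]
    simp
  · have h3 := congrArg (fun T => (1 / 2 : ℂ) • T) hsum
    simp only [← two_smul ℂ, smul_smul, smul_add, smul_sub] at h3
    rw [show (1 / 2 : ℂ) * 2 = 1 by norm_num, one_smul] at h3
    rw [← h3]
    simp only [mul_smul_comm, smul_mul_assoc, ← smul_sub]

end Tangent

/-! ### Local minimizers commute with A. -/

section Descent

open scoped Matrix.Norms.L2Operator

variable {d : ℕ} {N : Seminorm ℂ (Matrix (Fin d) (Fin d) ℂ)}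

/-- Moving from `l` towards a distinct point `k` of no larger norm, the norm decreases
linearly. -/
lemma IsStrictlyConvexOnDiagonals.exists_linear_decrease (hconv : IsStrictlyConvexOnDiagonals N)
    (hN : IsNorm N) {l k : Fin d → ℝ} (hlk : l ≠ k) (hle : N (diagMat k) ≤ N (diagMat l)) :
    ∃ δ > 0, ∀ t : ℝ, 0 ≤ t → t ≤ 1 / 2 →
      N (diagMat fun i => l i + t * (k i - l i)) ≤ N (diagMat l) - t * δ := by
  set m : Fin d → ℝ := (1 - (1 / 2 : ℝ)) • l + (1 / 2 : ℝ) • k with hm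
  have hlt : N (diagMat m) < N (diagMat l) := hconv.lt hN hlk hle (by norm_num) (by norm_num)
  refine ⟨2 * (N (diagMat l) - N (diagMat m)), by linarith, fun t h0 h1 => ?_⟩
  -- For t ≤ 1/2 the point lies between l and the midpoint m, so convexity on that segment turns the
  -- strict drop at m into a linear one.
  have hd : diagMat (fun i => l i + t * (k i - l i))
      = ((1 - 2 * t : ℝ) : ℂ) • diagMat l + ((2 * t : ℝ) : ℂ) • diagMat m := by
    ext i j
    by_cases h : i = j
    · subst h
      simp [diagMat, hm]
      ring
    · simp [diagMat, h]
  rw [hd]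
  calc _ ≤ N (((1 - 2 * t : ℝ) : ℂ) • diagMat l) + N (((2 * t : ℝ) : ℂ) • diagMat m) :=
        map_add_le_add N _ _
    _ = (1 - 2 * t) * N (diagMat l) + 2 * t * N (diagMat m) := by
        rw [map_smul_eq_mul, map_smul_eq_mul, Complex.norm_real, Complex.norm_real,
          Real.norm_of_nonneg (by linarith), Real.norm_of_nonneg (by linarith)]
    _ = _ := by ring

/-- If the average K differs from L, the orbit contains a curve through C that follows the path from
L to K to first order, up to unitary conjugation. -/
lemma IsLocalMinOn.commute (hN : IsNorm N) (hinv : IsUnitarilyInvariant N)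
    (hconv : IsStrictlyConvexOnDiagonals N) {A B C : Matrix (Fin d) (Fin d) ℂ}
    (hA : A.PosDef) (hC : C.PosDef) (hCB : C ∈ unitaryOrbit B)
    (hmin : IsLocalMinOn (logDist N A) (unitaryOrbit B) C) : Commute A C := by
  -- square roots of `A`
  obtain ⟨U, hU, hAU⟩ := exists_eq_diagAlgHom hA.isHermitian
  set a := hA.isHermitian.eigenvalues
  have ha : ∀ i, 0 < a i := hA.eigenvalues_pos
  set G := cfc Real.sqrt A with hGdef
  have hG : G = diagAlgHom U hU fun i => √(a i) := by
    rw [hGdef, hAU]; exact cfc_diagAlgHom _ hU _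
  set G' := invSqrt A with hG'def
  have hG' : G' = diagAlgHom U hU fun i => (√(a i))⁻¹ := by
    rw [hG'def, hAU]; exact invSqrt_diagAlgHom hU _
  have hGG' : G * G' = 1 := by
    rw [hG, hG', ← map_mul, ← map_one (diagAlgHom U hU)]
    congr 1
    funext i
    exact mul_inv_cancel₀ (Real.sqrt_pos.mpr (ha i)).ne'
  have hGG : G * G = A := by
    rw [hG, ← map_mul]
    conv_rhs => rw [hAU]
    congr 1
    funext i
    exact Real.mul_self_sqrt (ha i).le
  have hG'G : G' * G = 1 := mul_eq_one_comm.mp hGG'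
  have hcommG : ∀ Z : Matrix (Fin d) (Fin d) ℂ, Commute Z A → Commute Z G := fun Z hZ =>
    (Commute.cfc_real hZ.symm Real.sqrt).symm
  have hcommG' : ∀ Z : Matrix (Fin d) (Fin d) ℂ, Commute Z A → Commute Z G' := fun Z hZ =>
    (Commute.cfc_real hZ.symm _).symm
  have hG'h : G'.IsHermitian := hG' ▸ isHermitian_diagAlgHom hU _
  -- the matrix `M` and its logarithm
  set M := G' * C * G' with hM
  have hMpos : M.PosDef := by
    have := hC.conjTranspose_mul_mul_same (B := G')
      (Matrix.mulVec_injective_of_isUnit (IsUnit.of_mul_eq_one_right _ hGG'))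
    rwa [hG'h.eq] at this
  have hMh := hMpos.isHermitian
  obtain ⟨V, hV, hMV⟩ := exists_eq_diagAlgHom hMh
  set L := logm M with hL
  have hLV : L = diagAlgHom V hV fun i => Real.log (hMh.eigenvalues i) := by
    rw [hL]
    conv_lhs => rw [hMV]
    exact logm_diagAlgHom hV _
  have hLh : L.IsHermitian := hLV ▸ isHermitian_diagAlgHom hV _
  obtain ⟨K, hKh, hKN, hKA, hKC, hKtr⟩ :=
    exists_commuting_average N hinv hLh hA.isHermitian hC.isHermitian
  have hKM : Commute K M := ((hcommG' K hKA).mul_right hKC).mul_right (hcommG' K hKA)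
  have hKL : Commute L K := Commute.cfc_real hKM.symm _
  obtain ⟨W, hW, l, k, hLW, hKW⟩ := exists_simultaneous_diagAlgHom hLh hKh hKL
  have hMW : M = diagAlgHom W hW fun i => Real.exp (l i) := by
    have h1 : cfc Real.exp L = M := by
      rw [hLV]
      refine (cfc_diagAlgHom _ hV _).trans ?_
      conv_rhs => rw [hMV]
      congr 1
      funext i
      exact Real.exp_log (hMpos.eigenvalues_pos i)
    rw [← h1, hLW]
    exact cfc_diagAlgHom _ hW _
  have hCM : C = G * M * G := by
    calc C = (G * G') * C * (G' * G) := by rw [hGG', hG'G, one_mul, mul_one]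
      _ = _ := by rw [hM]; simp only [mul_assoc]
  by_cases hlk : l = k
  · -- `M` is a function of `K`, which commutes with `A`
    have hKL' : L = K := by rw [hLW, hKW, hlk]
    have hAL : Commute L A := hKL' ▸ hKA
    have hAM : Commute M A := by
      have h1 : cfc Real.exp L = M := by
        rw [hLW, hMW]
        exact cfc_diagAlgHom _ hW _
      rw [← h1]
      exact Commute.cfc_real hAL _
    have hAG : Commute A G := hcommG A (Commute.refl A)
    rw [hCM]
    exact (hAG.mul_right hAM.symm).mul_right hAG
  exfalso
  have hKl : N (diagMat k) ≤ N (diagMat l) := by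
    rw [← hinv.diagAlgHom hW, ← hinv.diagAlgHom hW, ← hKW, ← hLW]
    exact hKN
  obtain ⟨δ, hδ, hdec⟩ := hconv.exists_linear_decrease hN hlk hKl
  have hMKL : M * (K - L) = diagAlgHom W hW fun i => Real.exp (l i) * (k i - l i) := by
    rw [hMW, hKW, hLW, ← map_sub, ← map_mul]
    rfl
  obtain ⟨X, Y, hX, hY, hXY⟩ := exists_skew_tangent_solution hGG' hGG hM hcommG hC.isUnit hKtr
    hC.isHermitian hG'h (hMKL ▸ isHermitian_diagAlgHom hW _)
  -- the two curves
  set γ : ℝ → Matrix (Fin d) (Fin d) ℂ := fun t =>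
    NormedSpace.exp (t • (-X)) * C * NormedSpace.exp (t • X) with hγ
  set P : ℝ → Matrix (Fin d) (Fin d) ℂ := fun t => G' * γ t * G' with hP
  set q : ℝ → Fin d → ℝ := fun t i => Real.exp (l i + t * (k i - l i)) with hq
  set Q : ℝ → Matrix (Fin d) (Fin d) ℂ := fun t =>
    NormedSpace.exp (t • (-Y)) * diagAlgHom W hW (q t) * NormedSpace.exp (t • Y) with hQ
  have hγ0 : γ 0 = C := by simp [hγ]
  have hq0 : diagAlgHom W hW (q 0) = M := by rw [hMW]; simp [hq]
  have hγd : HasDerivAt γ (C * X - X * C) 0 := by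
    have := hasDerivAt_exp_conj X C (hasDerivAt_const (0 : ℝ) C) rfl
    rwa [zero_add] at this
  have hPd : HasDerivAt P (G' * (C * X - X * C) * G') 0 := (hγd.const_mul G').mul_const G'
  have hqd : HasDerivAt q (fun i => Real.exp (l i) * (k i - l i)) 0 := by
    refine hasDerivAt_pi.mpr fun i => ?_
    have h1 : HasDerivAt (fun t : ℝ => l i + t * (k i - l i)) (k i - l i) 0 := by
      simpa using ((hasDerivAt_id (0 : ℝ)).mul_const (k i - l i)).const_add (l i)
    simpa using h1.exp
  have hQd : HasDerivAt Q (M * (K - L) + (M * Y - Y * M)) 0 := by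
    rw [hMKL]
    exact hasDerivAt_exp_conj Y M (hasDerivAt_diagAlgHom hW hqd) hq0
  -- The tangent equation says that P, which comes from the orbit, and Q, whose logarithm has norm
  -- N(L + t(K − L)), agree to first order.
  have hPQd : HasDerivAt (fun t => P t - Q t) 0 0 := by
    have := hPd.sub hQd
    rw [← hXY] at this
    convert! this using 1
    abel
  have hPQ0 : P 0 - Q 0 = 0 := by
    simp only [hP, hγ0, hQ, hq0, zero_smul, NormedSpace.exp_zero, one_mul, mul_one]
    rw [sub_eq_zero]
  -- comparison of the logarithms
  obtain ⟨κ, hκ, hNκ⟩ := N.bound_of_continuous_normedSpace (continuous_seminorm N)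
  -- The number exp(−b) bounds the spectrum of Q t from below, uniformly for 0 ≤ t ≤ 1, as the
  -- Lipschitz estimate requires.
  set b : ℝ := ∑ i, (|l i| + |k i - l i|) with hb
  set c : ℝ := Real.exp (-b) with hc
  have hcpos : 0 < c := Real.exp_pos _
  have hexpY : ∀ t : ℝ, NormedSpace.exp (t • (-Y)) ∈ Matrix.unitaryGroup (Fin d) ℂ := fun t =>
    exp_smul_mem_unitaryGroup (by rw [Matrix.conjTranspose_neg, hY]) t
  have hQeq : ∀ t, Q t = diagAlgHom (NormedSpace.exp (t • (-Y)) * W)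
      (mul_mem (hexpY t) hW) (q t) := by
    intro t
    have h1 : NormedSpace.exp (t • Y) = (NormedSpace.exp (t • (-Y)))ᴴ := by
      rw [exp_smul_conjTranspose (by rw [Matrix.conjTranspose_neg, hY]), neg_neg]
    simp only [hQ, h1, diagAlgHom_apply, Matrix.conjTranspose_mul, mul_assoc]
  have hqc : ∀ t : ℝ, 0 ≤ t → t ≤ 1 → ∀ i, c ≤ q t i := by
    intro t h0 h1 i
    refine Real.exp_le_exp.mpr ?_
    have h2 : |l i| + |k i - l i| ≤ b :=
      Finset.single_le_sum (f := fun i => |l i| + |k i - l i|) (fun j _ => by positivity)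
        (Finset.mem_univ i)
    have h3 : -|l i| ≤ l i := neg_abs_le _
    have h4 : -|k i - l i| ≤ t * (k i - l i) := by
      have : |t * (k i - l i)| ≤ |k i - l i| := by
        rw [abs_mul, abs_of_nonneg h0]
        exact mul_le_of_le_one_left (abs_nonneg _) h1
      linarith [neg_abs_le (t * (k i - l i))]
    linarith
  have hexpX : ∀ t : ℝ, NormedSpace.exp (t • X) ∈ Matrix.unitaryGroup (Fin d) ℂ :=
    exp_smul_mem_unitaryGroup hX
  have hγX : ∀ t, γ t = (NormedSpace.exp (t • X))ᴴ * C * NormedSpace.exp (t • X) := fun t => by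
    rw [exp_smul_conjTranspose hX]
  have hγmem : ∀ t, γ t ∈ unitaryOrbit B := fun t => by
    rw [hγX]
    exact mem_unitaryOrbit_conj hCB (hexpX t)
  have hPh : ∀ t, (P t).IsHermitian := by
    intro t
    simp only [hP, hγX, Matrix.IsHermitian, Matrix.conjTranspose_mul, hG'h.eq,
      Matrix.conjTranspose_conjTranspose, hC.isHermitian.eq, mul_assoc]
  have hNQ : ∀ t, 0 ≤ t → t ≤ 1 / 2 → N (logm (Q t)) ≤ N L - t * δ := by
    intro t h0 h1
    rw [hQeq, logm_diagAlgHom, hinv.diagAlgHom, hLW, hinv.diagAlgHom]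
    simp only [hq, Real.log_exp]
    exact hdec t h0 h1
  -- With η = εt the logarithms differ by at most 6εt, which costs N at most 6κεt ≤ tδ/2, half of
  -- the gain tδ. The bound 1/2 keeps η ≤ 1/2.
  set ε : ℝ := min (δ / (12 * κ)) (1 / 2) with hε
  have hεpos : 0 < ε := lt_min (by positivity) (by norm_num)
  have hsmall : ∀ᶠ t in nhdsWithin (0 : ℝ) (Set.Ioi 0), ‖P t - Q t‖ ≤ ε * c * t := by
    have h1 := hasDerivAt_iff_isLittleO.mp hPQd
    have h2 := (h1.bound (mul_pos hεpos hcpos)).filter_mono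
      (nhdsWithin_le_nhds (s := Set.Ioi (0 : ℝ)))
    filter_upwards [h2, self_mem_nhdsWithin] with t ht ht0
    simpa [hPQ0, abs_of_pos (Set.mem_Ioi.mp ht0)] using ht
  have htend : Filter.Tendsto γ (nhdsWithin 0 (Set.Ioi 0)) (nhdsWithin C (unitaryOrbit B)) := by
    refine tendsto_nhdsWithin_iff.mpr ⟨?_, Filter.Eventually.of_forall hγmem⟩
    have := hγd.continuousAt.tendsto
    rw [hγ0] at this
    exact this.mono_left nhdsWithin_le_nhds
  have hIoo : ∀ᶠ t in nhdsWithin (0 : ℝ) (Set.Ioi 0), t ∈ Set.Ioo (0 : ℝ) (1 / 2) :=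
    Ioo_mem_nhdsGT (by norm_num)
  obtain ⟨t, ⟨hts, htm⟩, ht0, ht1⟩ := ((hsmall.and (htend.eventually hmin)).and hIoo).exists
  have hlog := norm_logm_sub_logm_le (hPh t) (hQeq t ▸ isHermitian_diagAlgHom _ _) hcpos
    (by
      rw [hQeq]
      exact algebraMap_le_diagAlgHom _ (hqc t ht0.le (by linarith)))
    (mul_nonneg hεpos.le ht0.le) (by
      have : ε ≤ 1 / 2 := min_le_right _ _
      nlinarith) (by linarith [hts] : ‖P t - Q t‖ ≤ ε * t * c)
  have hup : N (logm (P t)) ≤ N (logm (Q t)) + κ * (6 * (ε * t)) := by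
    calc N (logm (P t)) = N (logm (Q t) + (logm (P t) - logm (Q t))) := by
          rw [add_sub_cancel]
      _ ≤ N (logm (Q t)) + N (logm (P t) - logm (Q t)) := map_add_le_add N _ _
      _ ≤ _ := by
          gcongr
          exact (hNκ _).trans (by gcongr)
  have hlow : N L ≤ N (logm (P t)) := htm
  have hQt := hNQ t ht0.le ht1.le
  have hε' : ε * (12 * κ) ≤ δ := by
    have : ε ≤ δ / (12 * κ) := min_le_left _ _
    rwa [le_div_iff₀ (by positivity)] at this
  have : t * δ ≤ κ * (6 * (ε * t)) := by linarith
  have h6 : κ * (6 * (ε * t)) ≤ t * δ / 2 := by nlinarith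
  have : 0 < t * δ := mul_pos ht0 hδ
  linarith

end Descent

/-! ### Existence of a global minimizer and the common value of local minimizers. -/

section Global

variable {d : ℕ} {N : Seminorm ℂ (Matrix (Fin d) (Fin d) ℂ)}

open scoped Matrix.Norms.L2Operator in
lemma isCompact_unitaryGroup :
    IsCompact (Matrix.unitaryGroup (Fin d) ℂ : Set (Matrix (Fin d) (Fin d) ℂ)) := by
  refine Metric.isCompact_of_isClosed_isBounded (isClosed_unitary) ?_
  refine (Metric.isBounded_closedBall (x := (0 : Matrix (Fin d) (Fin d) ℂ))
    (r := ‖(1 : Matrix (Fin d) (Fin d) ℂ)‖)).subset ?_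
  intro U hU
  rw [mem_closedBall_zero_iff]
  simpa using (CStarRing.norm_mem_unitary_mul 1 hU).le

lemma isCompact_unitaryOrbit (B : Matrix (Fin d) (Fin d) ℂ) : IsCompact (unitaryOrbit B) := by
  have h : unitaryOrbit B = (fun U => Uᴴ * B * U) ''
      (Matrix.unitaryGroup (Fin d) ℂ : Set (Matrix (Fin d) (Fin d) ℂ)) := by
    ext C
    exact ⟨fun ⟨U, hU, h⟩ => ⟨U, hU, h.symm⟩, fun ⟨U, hU, h⟩ => ⟨U, hU, h.symm⟩⟩
  rw [h]
  exact isCompact_unitaryGroup.image (by fun_prop)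

lemma posDef_of_mem_unitaryOrbit {B C : Matrix (Fin d) (Fin d) ℂ} (hB : B.PosDef)
    (hC : C ∈ unitaryOrbit B) : C.PosDef := by
  obtain ⟨U, hU, rfl⟩ := hC
  have hU' : Uᴴ * U = 1 := Matrix.mem_unitaryGroup_iff'.mp hU
  exact hB.conjTranspose_mul_mul_same
    (Matrix.mulVec_injective_of_isUnit (IsUnit.of_mul_eq_one_right _ hU'))

lemma posDef_invSqrt_conj {A C : Matrix (Fin d) (Fin d) ℂ} (hA : A.PosDef) (hC : C.PosDef) :
    (invSqrt A * C * invSqrt A).PosDef := by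
  obtain ⟨U, hU, hAU⟩ := exists_eq_diagAlgHom hA.isHermitian
  have h : invSqrt A = diagAlgHom U hU fun i => (√(hA.isHermitian.eigenvalues i))⁻¹ := by
    conv_lhs => rw [hAU]
    exact invSqrt_diagAlgHom hU _
  have hpos : (invSqrt A).PosDef := by
    rw [h]
    exact posDef_diagAlgHom hU fun i => inv_pos.mpr (Real.sqrt_pos.mpr (hA.eigenvalues_pos i))
  have := hC.conjTranspose_mul_mul_same (B := invSqrt A)
    (Matrix.mulVec_injective_of_isUnit hpos.isUnit)
  rwa [hpos.isHermitian.eq] at this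

open scoped Matrix.Norms.L2Operator in
lemma continuousOn_logm :
    ContinuousOn logm {M : Matrix (Fin d) (Fin d) ℂ | M.PosDef} :=
  (CFC.continuousOn_log (A := Matrix (Fin d) (Fin d) ℂ)).mono fun _ hM =>
    ⟨hM.isHermitian.isSelfAdjoint, hM.isUnit⟩

lemma continuousOn_logDist {A B : Matrix (Fin d) (Fin d) ℂ} (hA : A.PosDef) (hB : B.PosDef) :
    ContinuousOn (logDist N A) (unitaryOrbit B) :=
  (continuous_seminorm N).comp_continuousOn
    (continuousOn_logm.comp (by fun_prop) fun _ hC =>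
      posDef_invSqrt_conj hA (posDef_of_mem_unitaryOrbit hB hC))

/-- Local minimizers of `logDist` on a unitary orbit are diagonalized by an eigenbasis of `A`, with
both spectra in non-increasing order. -/
lemma IsLocalMinOn.exists_aligned (hN : IsNorm N) (hinv : IsUnitarilyInvariant N)
    (hconv : IsStrictlyConvexOnDiagonals N) {A B C : Matrix (Fin d) (Fin d) ℂ}
    (hA : A.PosDef) (hB : B.PosDef) (hC : C ∈ unitaryOrbit B)
    (hmin : IsLocalMinOn (logDist N A) (unitaryOrbit B) C) :
    ∃ (U : Matrix (Fin d) (Fin d) ℂ) (hU : U ∈ Matrix.unitaryGroup (Fin d) ℂ),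
      A = diagAlgHom U hU (eigs hA.isHermitian) ∧ C = diagAlgHom U hU (eigs hB.isHermitian) :=
  IsLocalMinOn.exists_diagAlgHom_eigs hN hinv hconv hA hB hC hmin
    (IsLocalMinOn.commute hN hinv hconv hA (posDef_of_mem_unitaryOrbit hB hC) hC hmin)

/-- The value of `logDist` at a local minimizer. -/
lemma IsLocalMinOn.logDist_eq (hN : IsNorm N) (hinv : IsUnitarilyInvariant N)
    (hconv : IsStrictlyConvexOnDiagonals N) {A B C : Matrix (Fin d) (Fin d) ℂ}
    (hA : A.PosDef) (hB : B.PosDef) (hC : C ∈ unitaryOrbit B)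
    (hmin : IsLocalMinOn (logDist N A) (unitaryOrbit B) C) :
    logDist N A C
      = N (diagMat fun i => Real.log (eigs hB.isHermitian i / eigs hA.isHermitian i)) := by
  obtain ⟨U, hU, hAU, hCU⟩ := IsLocalMinOn.exists_aligned hN hinv hconv hA hB hC hmin
  have hpos : ∀ i, 0 < eigs hA.isHermitian i := pos_of_posDef_diagAlgHom hU (hAU ▸ hA)
  have h := logDist_diagAlgHom hinv hU hpos (eigs hB.isHermitian)
  rwa [← hAU, ← hCU] at h

end Global

end Procrustes

/-- Local minimizers are taken in the unitary orbit with the topology of the matrix space (the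
one induced by the operator norm, as by any other norm). -/
theorem theorem4p1 (d : ℕ) (A B : Matrix (Fin d) (Fin d) ℂ) (hA : A.PosDef) (hB : B.PosDef)
    (N : Seminorm ℂ (Matrix (Fin d) (Fin d) ℂ)) (hN : Procrustes.IsNorm N)
    (hinv : Procrustes.IsUnitarilyInvariant N)
    (hconv : Procrustes.IsStrictlyConvexOnDiagonals N)
    (C₀ : Matrix (Fin d) (Fin d) ℂ) (hC₀ : C₀ ∈ Procrustes.unitaryOrbit B)
    (hmin : IsLocalMinOn (Procrustes.logDist N A) (Procrustes.unitaryOrbit B) C₀) :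
    (∃ U ∈ Matrix.unitaryGroup (Fin d) ℂ,
      Uᴴ * A * U = Procrustes.diagMat (Procrustes.eigs hA.isHermitian) ∧
      Uᴴ * C₀ * U = Procrustes.diagMat (Procrustes.eigs hB.isHermitian)) ∧
    IsMinOn (Procrustes.logDist N A) (Procrustes.unitaryOrbit B) C₀ := by
  constructor
  · obtain ⟨U, hU, hAU, hCU⟩ :=
      Procrustes.IsLocalMinOn.exists_aligned hN hinv hconv hA hB hC₀ hmin
    refine ⟨U, hU, ?_, ?_⟩
    · rw [← Procrustes.conjTranspose_mul_diagAlgHom_mul hU, ← hAU]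
    · rw [← Procrustes.conjTranspose_mul_diagAlgHom_mul hU, ← hCU]
  -- A global minimizer C₁ is also a local one, so C₀ and C₁ share the value determined by the two
  -- spectra.
  · obtain ⟨C₁, hC₁, hmin₁⟩ := (Procrustes.isCompact_unitaryOrbit B).exists_isMinOn ⟨C₀, hC₀⟩
      (Procrustes.continuousOn_logDist (N := N) hA hB)
    intro C hC
    have h₀ := Procrustes.IsLocalMinOn.logDist_eq hN hinv hconv hA hB hC₀ hmin
    have h₁ := Procrustes.IsLocalMinOn.logDist_eq hN hinv hconv hA hB hC₁ hmin₁.localize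
    exact (h₀.trans h₁.symm).le.trans (hmin₁ hC)
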